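/- Let $(W,S)$ and $(U,T)$ be Coxeter systems. If $W$ acts on a set $X$, a map $f\colon S\to X$ is called $W$-equivariant if $w s_1 w^{-1}=s_2$ with $s_1,s_2\in S$, $w\in W$ implies $w.f(s_1)=f(s_2)$. Let $\Phi_U\subset V_U$ be the root system of $(U,T)$ in its standard geometric representation, i.e. the set of all $w.\alpha_t$ ($w\in U$, $t\in T$), where $(\alpha_t)_{t\in T}$ is the basis of $V_U$ with $\langle\alpha_t,\alpha_{t'}\rangle=-\cos(\pi/m_{t,t'})$ (read as $-1$ if $m_{t,t'}=\infty$) and $t$ acts as the reflection $\sigma_{\alpha_t}$, $\sigma_\alpha(v)=v-2\langle\alpha,v\rangle\alpha$. A root subsystem is a (possibly empty) subset $\Psi\subseteq\Phi_U$ with $\sigma_\alpha(\Psi)\subseteq\Psi$ for all $\alpha\in\Psi$; $\langle X\rangle$ denotes the smallest root subsystem containing $X\subseteq \Phi_U$. The set $\Sigma(\Phi_U)$ of root subsystems is a commutative monoid under $\Psi_1\cdot\Psi_2=\langle\Psi_1\cup\Psi_2\rangle$, with unit $\emptyset$, in which all elements are idempotent, and $U$ acts on it by monoid automorphisms. A Juyumaya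 map is a pair $(\phi,e)$ consisting of a group homomorphism $\phi\colon W\to U$ and a map $e\colon S\to\Sigma(\Phi_U)$ that is $W$-equivariant for the action $\rho_\phi$ of $W$ on $\Sigma(\Phi_U)$ through $\phi$, such that $$\langle e_{s_1}\cup w.e_{s_2}\rangle=\langle e_{s_1}\cup (s_1w).e_{s_2}\rangle\qquad\text{for all } s_1,s_2\in S,\ w\in W.$$ Let $\Sigma(\Phi_U)_{[e]}$ be the submonoid of $\Sigma(\Phi_U)$ generated by the elements $w.e_s$ ($w\in W$, $s\in S$); it is $W$-stable and contains the image of $e$. A Marin–Iwahori–Hecke monoid is a triple $(E,\rho,e)$ of a commutative monoid $E$, an action $\rho$ of $W$ on $E$ by monoid automorphisms, and a $W$-equivariant map $e$ from $S$ to the idempotents of $E$ such that $e_s x=e_s(s.x)$ for all $s\in S$, $x\in E$. Let $k$ be a commutative ring, $A$ a commutative $k$-algebra with an action $\rho$ of $W$ by $k$-algebra automorphisms, and $a\colon S\to A^\times$ a $W$-equivariant map. Let $B_W$ be the Artin braid group of $(W,S)$, with generators $g_s$ ($s\in S$), acting on $A$ through $B_W\to W$; for $w\in W$ put $g_w=g_{s_1}\cdots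 g_{s_n}$, where $w=s_1\cdots s_n$ is any reduced expression (the result does not depend on it). The Marin algebra $\mathcal E^{(W,S)}(A,\rho,a)$ is the quotient of the semidirect product $A\rtimes k[B_W]$ (in which $gc=(g.c)g$ for $g\in B_W$, $c\in A$) by the two-sided ideal generated by $g_s^2-a_s-(1-a_s)g_s$, $s\in S$; it is a left $A$-module by multiplication. For a commutative ring $R$ with trivial $W$-action and a $W$-equivariant map $u\colon S\to R^\times$, the Iwahori–Hecke algebra is $H_R(W,S)(u_s)=\mathcal E^{(W,S)}(R,\mathrm{triv},u)$. **Theorem.** Let $(\phi,e)$ be a Juyumaya map between $(W,S)$ and $(U,T)$, let $R$ be a commutative ring with trivial $W$-action and $u\colon S\to R^\times$ a $W$-equivariant map. Then: 1. $(\Sigma(\Phi_U)_{[e]},\rho_\phi,e)$ is a Marin–Iwahori–Hecke monoid. 2. With the induced action of $W$ on the monoid algebra $R[\Sigma(\Phi_U)_{[e]}]$ and $\hat e_s=1+(u_s-1)e_s\in R[\Sigma(\Phi_U)_{[e]}]^\times$, the algebra $\mathcal E^{(W,S)}(R[\Sigma(\Phi_U)_{[e]}],\rho_\phi,\hat e)$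 is a free left $R[\Sigma(\Phi_U)_{[e]}]$-module with basis $\{g_w\mid w\in W\}$. 3. The augmentation $\epsilon\colon R[\Sigma(\Phi_U)_{[e]}]\to R$ (sending every element of $\Sigma(\Phi_U)_{[e]}$ to $1$) induces a surjective homomorphism of $R$-algebras $$\mathcal E^{(W,S)}(R[\Sigma(\Phi_U)_{[e]}],\rho_\phi,\hat e)\longrightarrow H_R(W,S)(u_s),$$ equal to $\epsilon$ on $R[\Sigma(\Phi_U)_{[e]}]$ and to the identity on $B_W$. -/

import Mathlib

noncomputable section

namespace BraidsTies

/-! ### Equivariant maps on the simple reflections -/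

section Equivariant

variable {B W X : Type*} [Group W] {M : CoxeterMatrix B}

/-- The set `S` of simple reflections is indexed by `B`. A map `f : S → X` into a set acted on by
`W` is equivariant if `w s₁ w⁻¹ = s₂` implies `w.f(s₁) = f(s₂)`, for `w ∈ W` and `s₁, s₂ ∈ S`. -/
def IsEquivariant (cs : CoxeterSystem M W) (act : W → X → X) (f : B → X) : Prop :=
  ∀ (w : W) (i j : B), w * cs.simple i * w⁻¹ = cs.simple j → act w (f i) = f j

end Equivariant

/-! ### The standard geometric representation and its root system -/

section Geometric

variable {B W : Type*} [Group W] (M : CoxeterMatrix B)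

/-- The symmetric bilinear form on `ℝ^(B)` with `⟨αᵢ, αⱼ⟩ = -cos (π / mᵢⱼ)`. The entry `mᵢⱼ = ∞` is
encoded by `0`, and then the value is `-cos 0 = -1`, as it should be. -/
def geomForm : (B →₀ ℝ) →ₗ[ℝ] (B →₀ ℝ) →ₗ[ℝ] ℝ :=
  Finsupp.linearCombination ℝ fun i =>
    Finsupp.linearCombination ℝ fun j => -Real.cos (Real.pi / (M i j : ℝ))

/-- The simple root `αᵢ`, a basis vector. -/
def simpleRoot (i : B) : B →₀ ℝ := Finsupp.single i 1

/-- `σ_α : v ↦ v - 2⟨α, v⟩ α`, the reflection associated with a unit vector `α`. -/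
def refl (α : B →₀ ℝ) : Module.End ℝ (B →₀ ℝ) :=
  Module.preReflection α ((2 : ℝ) • geomForm M α)

theorem refl_apply (α v : B →₀ ℝ) : refl M α v = v - (2 * geomForm M α v) • α := by
  simp [refl, Module.preReflection_apply]

theorem geomForm_simpleRoot (i j : B) :
    geomForm M (simpleRoot i) (simpleRoot j) = -Real.cos (Real.pi / (M i j : ℝ)) := by
  simp [geomForm, simpleRoot]

theorem geomForm_simpleRoot_self (i : B) :
    ((2 : ℝ) • geomForm M (simpleRoot i)) (simpleRoot i) = 2 := by
  simp [geomForm_simpleRoot]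

theorem geomForm_comm (v w : B →₀ ℝ) : geomForm M v w = geomForm M w v := by
  have h : geomForm M = (geomForm M).flip := by
    refine Finsupp.lhom_ext' fun i => LinearMap.ext_ring ?_
    refine Finsupp.lhom_ext' fun j => LinearMap.ext_ring ?_
    have h1 := geomForm_simpleRoot M i j
    have h2 := geomForm_simpleRoot M j i
    rw [M.symmetric j i] at h2
    simpa [simpleRoot] using h1.trans h2.symm
  exact congrArg (fun f => f v w) h

/-- The reflection in a simple root, as an automorphism. -/
def simpleReflection (i : B) : (B →₀ ℝ) ≃ₗ[ℝ] (B →₀ ℝ) :=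
  Module.reflection (geomForm_simpleRoot_self M i)

theorem simpleReflection_apply (i : B) (v : B →₀ ℝ) :
    simpleReflection M i v = refl M (simpleRoot i) v := rfl

open Polynomial.Chebyshev in
theorem simpleReflection_isLiftable : M.IsLiftable (simpleReflection M) := by
  intro i j
  by_cases hij : i = j
  · subst hij
    rw [M.diagonal, pow_one]
    ext1 v
    exact Module.involutive_reflection (geomForm_simpleRoot_self M i) v
  obtain hm0 | hm1 | hm2 | hm : M i j = 0 ∨ M i j = 1 ∨ M i j = 2 ∨ 3 ≤ M i j := by omega
  · rw [hm0, pow_zero]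
  · exact absurd hm1 (M.off_diagonal i j hij)
  · have hc : geomForm M (simpleRoot i) (simpleRoot j) = 0 := by
      simp [geomForm_simpleRoot, hm2]
    have hc' : geomForm M (simpleRoot j) (simpleRoot i) = 0 := by rw [geomForm_comm, hc]
    have h1 := geomForm_simpleRoot_self M i
    have h2 := geomForm_simpleRoot_self M j
    rw [hm2]
    ext1 v
    simp only [LinearMap.smul_apply, smul_eq_mul] at h1 h2
    simp only [pow_two, LinearEquiv.mul_apply, simpleReflection_apply, refl_apply, map_sub,
      map_smul, hc, hc']
    have h1' : geomForm M (simpleRoot i) (simpleRoot i) = 1 := by linarith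
    have h2' : geomForm M (simpleRoot j) (simpleRoot j) = 1 := by linarith
    rw [h1', h2']
    change _ = v
    module
  · set m := M i j with hmdef
    have hm0 : (m : ℝ) ≠ 0 := by positivity
    set θ : ℝ := 2 * Real.pi / m with hθ
    have hmθ : (m : ℝ) * θ = 2 * Real.pi := by rw [hθ]; field_simp
    have hsin : Real.sin θ ≠ 0 := by
      have h3 : (3 : ℝ) ≤ m := by exact_mod_cast hm
      have hpos : 0 < θ := by rw [hθ]; positivity
      have hlt : θ < Real.pi := by
        rw [hθ, div_lt_iff₀ (by positivity)]
        nlinarith [Real.pi_pos]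
      exact (Real.sin_pos_of_pos_of_lt_pi hpos hlt).ne'
    have hfy : ((2 : ℝ) • geomForm M (simpleRoot i)) (simpleRoot j)
        = -(2 * Real.cos (Real.pi / m)) := by
      simp [geomForm_simpleRoot, hmdef]
    have hgx : ((2 : ℝ) • geomForm M (simpleRoot j)) (simpleRoot i)
        = -(2 * Real.cos (Real.pi / m)) := by
      rw [← hfy]; simp [geomForm_comm M (simpleRoot j) (simpleRoot i)]
    have ht : 2 * Real.cos θ = ((2 : ℝ) • geomForm M (simpleRoot i)) (simpleRoot j) *
        ((2 : ℝ) • geomForm M (simpleRoot j)) (simpleRoot i) - 2 := by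
      rw [hfy, hgx, hθ, mul_div_assoc, Real.cos_two_mul]; ring
    ext1 v
    have key := Module.reflection_mul_reflection_pow_apply (geomForm_simpleRoot_self M i)
      (geomForm_simpleRoot_self M j) m v (2 * Real.cos θ) ht
    change ((Module.reflection (geomForm_simpleRoot_self M i) *
      Module.reflection (geomForm_simpleRoot_self M j)) ^ m) v = v
    rw [key]
    have hS (n : ℤ) := S_two_mul_real_cos θ n
    obtain ⟨k, hk | hk⟩ : ∃ k : ℕ, m = 2 * k ∨ m = 2 * k + 1 := ⟨m / 2, by omega⟩
    · have hz : (S ℝ ((k : ℤ) - 1)).eval (2 * Real.cos θ) = 0 := by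
        have h := hS ((k : ℤ) - 1)
        have h2 : ((((k : ℤ) - 1 : ℤ) : ℝ) + 1) * θ = Real.pi := by
          rw [hk] at hmθ; push_cast at hmθ ⊢; linarith
        rw [h2, Real.sin_pi] at h
        exact (mul_eq_zero.mp h).resolve_right hsin
      have e1 : ((m : ℤ) - 2) / 2 = (k : ℤ) - 1 := by omega
      have e2 : ((m : ℤ) - 1) / 2 = (k : ℤ) - 1 := by omega
      rw [e1, e2, hz]; simp
    · have hz : (S ℝ (k : ℤ)).eval (2 * Real.cos θ)
          + (S ℝ ((k : ℤ) - 1)).eval (2 * Real.cos θ) = 0 := by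
        have h := hS (k : ℤ)
        have h' := hS ((k : ℤ) - 1)
        have h2 : (((k : ℤ) : ℝ) + 1) * θ
            = 2 * Real.pi - ((((k : ℤ) - 1 : ℤ) : ℝ) + 1) * θ := by
          rw [hk] at hmθ; push_cast at hmθ ⊢; linarith
        rw [h2, Real.sin_two_pi_sub] at h
        have h3 : ((S ℝ (k : ℤ)).eval (2 * Real.cos θ)
          + (S ℝ ((k : ℤ) - 1)).eval (2 * Real.cos θ)) * Real.sin θ = 0 := by
          rw [add_mul, h, h']; ring
        exact (mul_eq_zero.mp h3).resolve_right hsin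
      have e1 : ((m : ℤ) - 2) / 2 = (k : ℤ) - 1 := by omega
      have e2 : ((m : ℤ) - 1) / 2 = (k : ℤ) := by omega
      have e3 : ((m : ℤ) - 3) / 2 = (k : ℤ) - 1 := by omega
      have e4 : (m : ℤ) / 2 = (k : ℤ) := by omega
      rw [e1, e2, e3, e4, hz]; simp

variable {M} (cs : CoxeterSystem M W)

/-- The standard geometric representation of a Coxeter system, `sᵢ ↦ σ_{αᵢ}`. -/
def geomRep : W →* ((B →₀ ℝ) ≃ₗ[ℝ] (B →₀ ℝ)) :=
  cs.lift ⟨simpleReflection M, simpleReflection_isLiftable M⟩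

theorem geomRep_simple (i : B) : geomRep cs (cs.simple i) = simpleReflection M i :=
  cs.lift_apply_simple (simpleReflection_isLiftable M) i

theorem geomForm_geomRep (w : W) (v v' : B →₀ ℝ) :
    geomForm M (geomRep cs w v) (geomRep cs w v') = geomForm M v v' := by
  induction w using cs.simple_induction generalizing v v' with
  | simple i =>
    have h1 := geomForm_simpleRoot_self M i
    simp only [LinearMap.smul_apply, smul_eq_mul] at h1
    have h1' : geomForm M (simpleRoot i) (simpleRoot i) = 1 := by linarith
    simp only [geomRep_simple, simpleReflection_apply, refl_apply, map_sub, map_smul,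
      LinearMap.sub_apply, LinearMap.smul_apply, smul_eq_mul, h1',
      geomForm_comm M v (simpleRoot i)]
    ring
  | one => simp
  | mul a b ha hb => simp only [map_mul, LinearEquiv.mul_apply, ha, hb]

theorem geomRep_refl (w : W) (α v : B →₀ ℝ) :
    geomRep cs w (refl M α v) = refl M (geomRep cs w α) (geomRep cs w v) := by
  simp [refl_apply, geomForm_geomRep]

/-- The root system `Φ = {w.αᵢ}`. -/
def roots : Set (B →₀ ℝ) := {v | ∃ (w : W) (i : B), v = geomRep cs w (simpleRoot i)}

theorem geomRep_mem_roots (w : W) {v : B →₀ ℝ} (hv : v ∈ roots cs) :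
    geomRep cs w v ∈ roots cs := by
  obtain ⟨w', i, rfl⟩ := hv
  exact ⟨w * w', i, by simp⟩

theorem refl_mem_roots {α β : B →₀ ℝ} (hα : α ∈ roots cs) (hβ : β ∈ roots cs) :
    refl M α β ∈ roots cs := by
  obtain ⟨w, i, rfl⟩ := hα
  have h : refl M (geomRep cs w (simpleRoot i)) β
      = geomRep cs (w * cs.simple i * w⁻¹) β := by
    have hβ' : β = geomRep cs w (geomRep cs w⁻¹ β) := by
      rw [← LinearEquiv.mul_apply, ← map_mul]; simp
    conv_lhs => rw [hβ', ← geomRep_refl]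
    simp only [map_mul, LinearEquiv.mul_apply, geomRep_simple, simpleReflection_apply]
  rw [h]
  exact geomRep_mem_roots cs _ hβ

/-! ### The monoid of root subsystems -/

/-- A root subsystem of `Φ`: a subset `Ψ ⊆ Φ` stable under the reflections in its own elements
(hence also under `α ↦ -α = σ_α(α)`). The empty set is one. -/
@[ext]
structure RootSubsystem where
  /-- The underlying set of roots. -/
  carrier : Set (B →₀ ℝ)
  subset_roots : carrier ⊆ roots cs
  refl_mem : ∀ ⦃α⦄, α ∈ carrier → ∀ ⦃β⦄, β ∈ carrier → refl M α β ∈ carrier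

namespace RootSubsystem

variable {cs}

/-- `⟨X⟩`, the root subsystem generated by a set `X ⊆ Φ` of roots: the intersection of all root
subsystems containing `X`. -/
def generate (X : Set (B →₀ ℝ)) : RootSubsystem cs where
  carrier := {v | v ∈ roots cs ∧ ∀ Ψ : RootSubsystem cs, X ⊆ Ψ.carrier → v ∈ Ψ.carrier}
  subset_roots := fun _ h => h.1
  refl_mem := fun _ hα _ hβ =>
    ⟨refl_mem_roots cs hα.1 hβ.1, fun Ψ hΨ => Ψ.refl_mem (hα.2 Ψ hΨ) (hβ.2 Ψ hΨ)⟩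

theorem subset_generate {X : Set (B →₀ ℝ)} (hX : X ⊆ roots cs) :
    X ⊆ (generate X : RootSubsystem cs).carrier :=
  fun _ hv => ⟨hX hv, fun _ hΨ => hΨ hv⟩

theorem generate_subset {X : Set (B →₀ ℝ)} {Ψ : RootSubsystem cs} (h : X ⊆ Ψ.carrier) :
    (generate X : RootSubsystem cs).carrier ⊆ Ψ.carrier :=
  fun _ hv => hv.2 Ψ h

/-- The product `Ψ₁ · Ψ₂ = ⟨Ψ₁, Ψ₂⟩`. -/
instance : Mul (RootSubsystem cs) := ⟨fun Ψ₁ Ψ₂ => generate (Ψ₁.carrier ∪ Ψ₂.carrier)⟩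

/-- The unit is the empty root subsystem. -/
instance : One (RootSubsystem cs) :=
  ⟨{ carrier := ∅
     subset_roots := Set.empty_subset _
     refl_mem := fun _ h => h.elim }⟩

theorem mul_def (Ψ₁ Ψ₂ : RootSubsystem cs) :
    Ψ₁ * Ψ₂ = generate (Ψ₁.carrier ∪ Ψ₂.carrier) := rfl

theorem one_carrier : (1 : RootSubsystem cs).carrier = ∅ := rfl

theorem left_subset_mul (Ψ₁ Ψ₂ : RootSubsystem cs) : Ψ₁.carrier ⊆ (Ψ₁ * Ψ₂).carrier :=
  Set.subset_union_left.trans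
    (subset_generate (Set.union_subset Ψ₁.subset_roots Ψ₂.subset_roots))

theorem right_subset_mul (Ψ₁ Ψ₂ : RootSubsystem cs) : Ψ₂.carrier ⊆ (Ψ₁ * Ψ₂).carrier :=
  Set.subset_union_right.trans
    (subset_generate (Set.union_subset Ψ₁.subset_roots Ψ₂.subset_roots))

theorem mul_subset {Ψ₁ Ψ₂ Ψ : RootSubsystem cs} (h₁ : Ψ₁.carrier ⊆ Ψ.carrier)
    (h₂ : Ψ₂.carrier ⊆ Ψ.carrier) : (Ψ₁ * Ψ₂).carrier ⊆ Ψ.carrier :=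
  generate_subset (Set.union_subset h₁ h₂)

theorem mul_self (Ψ : RootSubsystem cs) : Ψ * Ψ = Ψ :=
  RootSubsystem.ext ((mul_subset subset_rfl subset_rfl).antisymm (left_subset_mul Ψ Ψ))

instance : CommMonoid (RootSubsystem cs) where
  mul_assoc a b c := by
    refine RootSubsystem.ext (Set.Subset.antisymm ?_ ?_)
    · refine mul_subset (mul_subset (left_subset_mul _ _) ?_) ?_
      · exact (left_subset_mul b c).trans (right_subset_mul a _)
      · exact (right_subset_mul b c).trans (right_subset_mul a _)
    · refine mul_subset ?_ (mul_subset ?_ (right_subset_mul _ _))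
      · exact (left_subset_mul a b).trans (left_subset_mul _ c)
      · exact (right_subset_mul a b).trans (left_subset_mul _ c)
  one_mul a := RootSubsystem.ext
    ((mul_subset (Set.empty_subset _) subset_rfl).antisymm (right_subset_mul _ _))
  mul_one a := RootSubsystem.ext
    ((mul_subset subset_rfl (Set.empty_subset _)).antisymm (left_subset_mul _ _))
  mul_comm a b := RootSubsystem.ext
    ((mul_subset (right_subset_mul _ _) (left_subset_mul _ _)).antisymm
      (mul_subset (right_subset_mul _ _) (left_subset_mul _ _)))

/-- The action of an element `w` on root subsystems: `w.Ψ = {w.α | α ∈ Ψ}`. -/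
def translate (w : W) (Ψ : RootSubsystem cs) : RootSubsystem cs where
  carrier := geomRep cs w '' Ψ.carrier
  subset_roots := by
    rintro _ ⟨v, hv, rfl⟩
    exact geomRep_mem_roots cs w (Ψ.subset_roots hv)
  refl_mem := by
    rintro _ ⟨α, hα, rfl⟩ _ ⟨β, hβ, rfl⟩
    exact ⟨_, Ψ.refl_mem hα hβ, geomRep_refl cs w α β⟩

theorem translate_one (Ψ : RootSubsystem cs) : translate 1 Ψ = Ψ := by
  ext v; simp [translate]

theorem translate_mul (w w' : W) (Ψ : RootSubsystem cs) :
    translate (w * w') Ψ = translate w (translate w' Ψ) := by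
  ext v; simp [translate]

theorem translate_mono (w : W) {Ψ Ψ' : RootSubsystem cs} (h : Ψ.carrier ⊆ Ψ'.carrier) :
    (translate w Ψ).carrier ⊆ (translate w Ψ').carrier :=
  Set.image_mono h

theorem translate_prod (w : W) (Ψ Ψ' : RootSubsystem cs) :
    translate w (Ψ * Ψ') = translate w Ψ * translate w Ψ' := by
  have hge (w : W) (Ψ Ψ' : RootSubsystem cs) :
      (translate w Ψ * translate w Ψ').carrier ⊆ (translate w (Ψ * Ψ')).carrier :=
    mul_subset (translate_mono w (left_subset_mul _ _)) (translate_mono w (right_subset_mul _ _))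
  refine RootSubsystem.ext (Set.Subset.antisymm ?_ (hge w Ψ Ψ'))
  have h := translate_mono w (hge w⁻¹ (translate w Ψ) (translate w Ψ'))
  simpa only [← translate_mul, inv_mul_cancel, mul_inv_cancel, translate_one] using h

/-- The canonical action of the Coxeter group on the monoid of root subsystems, by monoid
automorphisms. -/
def action (cs : CoxeterSystem M W) : W →* MulAut (RootSubsystem cs) where
  toFun w :=
    { toFun := translate w
      invFun := translate w⁻¹
      left_inv := fun Ψ => by rw [← translate_mul, inv_mul_cancel, translate_one]
      right_inv := fun Ψ => by rw [← translate_mul, mul_inv_cancel, translate_one]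
      map_mul' := translate_prod w }
  map_one' := MulEquiv.ext translate_one
  map_mul' w w' := MulEquiv.ext (translate_mul w w')

end RootSubsystem

end Geometric

/-! ### Marin–Iwahori–Hecke monoids -/

section Monoids

variable {B W E : Type*} [Group W] {M : CoxeterMatrix B} [CommMonoid E]

/-- `(E, ρ, e)` is a Marin–Iwahori–Hecke monoid: `e` is an equivariant map from `S` to the
idempotents of `E`, and `e_s (1 - ρ_s) = 0`, that is `e_s x = e_s (s.x)` for all `x ∈ E`. -/
structure IsMarinIwahoriHeckeMonoid (cs : CoxeterSystem M W) (ρ : W →* MulAut E) (e : B → E) :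
    Prop where
  idempotent : ∀ i, IsIdempotentElem (e i)
  equivariant : IsEquivariant cs (fun w x => ρ w x) e
  mul_eq : ∀ i x, e i * x = e i * ρ (cs.simple i) x

/-- `E_[e]`, the submonoid generated by the elements `w.e_s`, for `w ∈ W` and `s ∈ S`. -/
def orbitSubmonoid (ρ : W →* MulAut E) (e : B → E) : Submonoid E :=
  Submonoid.closure {x | ∃ (w : W) (i : B), x = ρ w (e i)}

theorem orbitSubmonoid_stable (ρ : W →* MulAut E) (e : B → E) (w : W) {x : E}
    (hx : x ∈ orbitSubmonoid ρ e) : ρ w x ∈ orbitSubmonoid ρ e := by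
  have h : orbitSubmonoid ρ e ≤ (orbitSubmonoid ρ e).comap (ρ w).toMonoidHom := by
    refine Submonoid.closure_le.mpr ?_
    rintro _ ⟨w', i, rfl⟩
    exact Submonoid.subset_closure ⟨w * w', i, by simp⟩
  exact h hx

/-- The restriction of the action `ρ` to `E_[e]`. -/
def orbitAction (ρ : W →* MulAut E) (e : B → E) : W →* MulAut (orbitSubmonoid ρ e) where
  toFun w :=
    { toFun := fun x => ⟨ρ w x, orbitSubmonoid_stable ρ e w x.2⟩
      invFun := fun x => ⟨ρ w⁻¹ x, orbitSubmonoid_stable ρ e w⁻¹ x.2⟩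
      left_inv := fun x => Subtype.ext (by simp)
      right_inv := fun x => Subtype.ext (by simp)
      map_mul' := fun x y => Subtype.ext (by simp) }
  map_one' := by ext x; simp
  map_mul' w w' := by ext x; simp

/-- The map `e`, with values in `E_[e]`. -/
def orbitMap (ρ : W →* MulAut E) (e : B → E) (i : B) : orbitSubmonoid ρ e :=
  ⟨e i, Submonoid.subset_closure ⟨1, i, by simp⟩⟩

end Monoids

/-! ### The Artin braid group -/

section Artin

variable {B W : Type*} [Group W] (M : CoxeterMatrix B)

/-- The braid relations `sᵢsⱼsᵢ⋯ = sⱼsᵢsⱼ⋯` (`mᵢⱼ` factors on each side). There is no relation for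
`mᵢⱼ = ∞`, encoded by `0`: both words are then empty. -/
def artinRelations : Set (FreeGroup B) :=
  {r | ∃ i j : B, r = ((CoxeterSystem.braidWord M i j).map FreeGroup.of).prod *
    (((CoxeterSystem.braidWord M j i).map FreeGroup.of).prod)⁻¹}

/-- The Artin braid group of the Coxeter matrix `M`. -/
abbrev ArtinGroup : Type _ := PresentedGroup (artinRelations M)

/-- The product `g_{s₁} ⋯ g_{sₖ}` in the Artin group of the generators along a word. On the reduced
words of `w` it is the canonical lift `g_w` of `w ∈ W`. -/
def artinWord (ω : List B) : ArtinGroup M :=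
  (ω.map fun i => (PresentedGroup.of i : ArtinGroup M)).prod

variable {M}

/-- The projection of the Artin group onto the Coxeter group. -/
def artinProj (cs : CoxeterSystem M W) : ArtinGroup M →* W :=
  PresentedGroup.toGroup (f := cs.simple) (by
    rintro _ ⟨i, j, rfl⟩
    have h := cs.wordProd_braidWord_eq i j
    simp only [CoxeterSystem.wordProd] at h
    simp only [map_mul, map_inv, map_list_prod, List.map_map, Function.comp_def,
      FreeGroup.lift_apply_of]
    rw [mul_inv_eq_one]
    exact h)

end Artin

/-! ### Marin data and Marin algebras -/

section Marin

variable {B W : Type*} [Group W] {M : CoxeterMatrix B}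

/-- A Marin datum with Coxeter system `cs`: an action of `W` on the commutative `k`-algebra `A` and an
equivariant map `a : S → Aˣ`. -/
structure MarinDatum (cs : CoxeterSystem M W) (k A : Type*) [CommRing k] [CommRing A]
    [Algebra k A] where
  /-- The action of `W` on `A`. -/
  ρ : W →* (A ≃ₐ[k] A)
  /-- The equivariant map. -/
  a : B → Aˣ
  equivariant : IsEquivariant cs (fun w x => Units.map (ρ w : A →* A) x) a

namespace MarinDatum

variable {cs : CoxeterSystem M W} {k A : Type*} [CommRing k] [CommRing A] [Algebra k A]

/-- The algebra `A` of a Marin datum, carrying the action of the Artin group through `W`. -/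
def Coeff (_D : MarinDatum cs k A) : Type _ := A

variable (D : MarinDatum cs k A)

instance : CommRing D.Coeff := inferInstanceAs (CommRing A)

instance : Algebra k D.Coeff := inferInstanceAs (Algebra k A)

/-- The identity map from `A` to `D.Coeff`. -/
def toCoeff : A ≃ₐ[k] D.Coeff := AlgEquiv.refl

instance : MulSemiringAction (ArtinGroup M) D.Coeff where
  smul x c := D.toCoeff (D.ρ (artinProj cs x) (D.toCoeff.symm c))
  one_smul c := by
    change D.toCoeff (D.ρ (artinProj cs 1) (D.toCoeff.symm c)) = c
    simp
  mul_smul x y c := by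
    change D.toCoeff (D.ρ (artinProj cs (x * y)) (D.toCoeff.symm c)) =
      D.toCoeff (D.ρ (artinProj cs x) (D.toCoeff.symm
        (D.toCoeff (D.ρ (artinProj cs y) (D.toCoeff.symm c)))))
    simp
  smul_zero x := by
    change D.toCoeff (D.ρ (artinProj cs x) (D.toCoeff.symm 0)) = 0
    simp
  smul_add x c d := by
    change D.toCoeff (D.ρ (artinProj cs x) (D.toCoeff.symm (c + d))) =
      D.toCoeff (D.ρ (artinProj cs x) (D.toCoeff.symm c)) +
      D.toCoeff (D.ρ (artinProj cs x) (D.toCoeff.symm d))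
    simp
  smul_one x := by
    change D.toCoeff (D.ρ (artinProj cs x) (D.toCoeff.symm 1)) = 1
    simp
  smul_mul x c d := by
    change D.toCoeff (D.ρ (artinProj cs x) (D.toCoeff.symm (c * d))) =
      D.toCoeff (D.ρ (artinProj cs x) (D.toCoeff.symm c)) *
      D.toCoeff (D.ρ (artinProj cs x) (D.toCoeff.symm d))
    simp

theorem artin_smul_def (x : ArtinGroup M) (c : D.Coeff) :
    x • c = D.toCoeff (D.ρ (artinProj cs x) (D.toCoeff.symm c)) := rfl

instance : SMulCommClass (ArtinGroup M) k D.Coeff where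
  smul_comm x r c := by simp [artin_smul_def]

/-- The semidirect product `A ⋊ k[B_W]`: sums of elements `c g` with `c ∈ A` and `g ∈ B_W`, with the
rule `g c = (g.c) g`. -/
abbrev Semidirect : Type _ := SkewMonoidAlgebra D.Coeff (ArtinGroup M)

/-- The relations `g_s² = a_s + (1 - a_s) g_s`, for `s ∈ S`. -/
inductive Rel : D.Semidirect → D.Semidirect → Prop
  | quadratic (i : B) :
      Rel (SkewMonoidAlgebra.single (PresentedGroup.of i) 1 ^ 2)
        (SkewMonoidAlgebra.single 1 (D.toCoeff (D.a i)) +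
          SkewMonoidAlgebra.single 1 (1 - D.toCoeff (D.a i)) *
            SkewMonoidAlgebra.single (PresentedGroup.of i) 1)

/-- The Marin algebra of the datum: the quotient of `A ⋊ k[B_W]` by the two-sided ideal generated by
the elements `g_s² - a_s - (1 - a_s) g_s`. -/
def MarinAlgebra : Type _ := RingQuot D.Rel

instance : Ring D.MarinAlgebra := inferInstanceAs (Ring (RingQuot D.Rel))

instance : Algebra k D.MarinAlgebra := inferInstanceAs (Algebra k (RingQuot D.Rel))

/-- The quotient map. -/
def quotientMap : D.Semidirect →ₐ[k] D.MarinAlgebra := RingQuot.mkAlgHom k D.Rel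

/-- The canonical map from `A` to the Marin algebra. -/
def coeffHom : D.Coeff →+* D.MarinAlgebra :=
  (D.quotientMap : D.Semidirect →+* D.MarinAlgebra).comp SkewMonoidAlgebra.singleOneRingHom

/-- The canonical map from the Artin group to the Marin algebra. -/
def gen : ArtinGroup M →* D.MarinAlgebra :=
  (D.quotientMap : D.Semidirect →* D.MarinAlgebra).comp (SkewMonoidAlgebra.of D.Coeff (ArtinGroup M))

/-- The left `A`-module structure of the Marin algebra: `c • x = c x`. -/
instance : Module D.Coeff D.MarinAlgebra := Module.compHom D.MarinAlgebra D.coeffHom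

end MarinDatum

/-- The Marin datum `(R, trivial action, u)`. -/
def heckeDatum (cs : CoxeterSystem M W) {R : Type*} [CommRing R] (u : B → Rˣ)
    (hu : IsEquivariant cs (fun _ r => r) u) : MarinDatum cs R R where
  ρ := 1
  a := u
  equivariant := fun w i j h => by
    rw [← hu w i j h]
    ext
    simp

/-- The Iwahori–Hecke algebra `H_R(W,S)(u_s)`: the `R`-algebra on generators `g_s`, subject to the
braid relations and to `g_s² = u_s + (1 - u_s) g_s`. -/
abbrev IwahoriHeckeAlgebra (cs : CoxeterSystem M W) {R : Type*} [CommRing R] (u : B → Rˣ)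
    (hu : IsEquivariant cs (fun _ r => r) u) : Type _ :=
  (heckeDatum cs u hu).MarinAlgebra

variable {E : Type*} [CommMonoid E]

/-- The unit `ê_s = 1 + (u_s - 1) e_s` of `R[E]`, for an idempotent `e_s` of `E`. -/
def hatUnit {R : Type*} [CommRing R] (u : Rˣ) (e : E) (he : IsIdempotentElem e) :
    (MonoidAlgebra R E)ˣ where
  val := 1 + MonoidAlgebra.single e ((u : R) - 1)
  inv := 1 + MonoidAlgebra.single e (((u⁻¹ : Rˣ) : R) - 1)
  val_inv := by
    have h : ((u : R) - 1) * (((u⁻¹ : Rˣ) : R) - 1)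
        = -(((u : R) - 1) + (((u⁻¹ : Rˣ) : R) - 1)) := by
      linear_combination u.mul_inv
    rw [add_mul, mul_add, mul_add, MonoidAlgebra.single_mul_single, he.eq, h,
      MonoidAlgebra.single_neg, MonoidAlgebra.single_add]
    simp only [one_mul, mul_one]
    abel
  inv_val := by
    have h : (((u⁻¹ : Rˣ) : R) - 1) * ((u : R) - 1)
        = -(((u : R) - 1) + (((u⁻¹ : Rˣ) : R) - 1)) := by
      linear_combination u.mul_inv
    rw [add_mul, mul_add, mul_add, MonoidAlgebra.single_mul_single, he.eq, h,
      MonoidAlgebra.single_neg, MonoidAlgebra.single_add]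
    simp only [one_mul, mul_one]
    abel

/-- The action of `W` on `R[E]` induced by an action on the commutative monoid `E`. -/
def monoidAlgebraAction (R : Type*) [CommRing R] (ρ : W →* MulAut E) :
    W →* (MonoidAlgebra R E ≃ₐ[R] MonoidAlgebra R E) where
  toFun w := MonoidAlgebra.domCongr R R (ρ w)
  map_one' := by
    ext f x
    simp
    rfl
  map_mul' w w' := by
    ext f x
    simp
    rfl

/-- The Marin datum `(R[E], ρ, ê)` attached to a commutative monoid `E` with an action `ρ` and an
equivariant map `e` from `S` to the idempotents of `E`. -/
def monoidDatum (cs : CoxeterSystem M W) {R : Type*} [CommRing R] (ρ : W →* MulAut E) (e : B → E)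
    (he : ∀ i, IsIdempotentElem (e i)) (heq : IsEquivariant cs (fun w x => ρ w x) e)
    (u : B → Rˣ) (hu : IsEquivariant cs (fun _ r => r) u) :
    MarinDatum cs R (MonoidAlgebra R E) where
  ρ := monoidAlgebraAction R ρ
  a i := hatUnit (u i) (e i) (he i)
  equivariant := fun w i j h => by
    have h1 := hu w i j h
    have h2 := heq w i j h
    ext1
    simp only at h1 h2
    simp [hatUnit, monoidAlgebraAction, h1, h2]

/-- The augmentation `R[E] → R`, sending all elements of `E` to `1`. -/
def augmentation (R E : Type*) [CommRing R] [CommMonoid E] : MonoidAlgebra R E →ₐ[R] R :=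
  MonoidAlgebra.lift R R E 1

end Marin

/-! ### Juyumaya maps -/

section Juyumaya

variable {B W B' U : Type*} [Group W] [Group U] {M : CoxeterMatrix B} {N : CoxeterMatrix B'}

/-- The action `ρ_φ` of `W` on the root subsystems of `Φ_U` through `φ : W → U`. -/
def rhoPhi (ct : CoxeterSystem N U) (φ : W →* U) : W →* MulAut (RootSubsystem ct) :=
  (RootSubsystem.action ct).comp φ

/-- `(φ, e)` is a Juyumaya map between `(W,S)` and `(U,T)`: `e : S → Σ(Φ_U)` is equivariant via `φ`
and `⟨e_{s₁}, w.e_{s₂}⟩ = ⟨e_{s₁}, (s₁w).e_{s₂}⟩` for all `s₁, s₂ ∈ S` and `w ∈ W`. -/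
structure IsJuyumayaMap (cs : CoxeterSystem M W) (ct : CoxeterSystem N U) (φ : W →* U)
    (e : B → RootSubsystem ct) : Prop where
  equivariant : IsEquivariant cs (fun w Ψ => rhoPhi ct φ w Ψ) e
  generate_eq : ∀ (i j : B) (w : W),
    (RootSubsystem.generate ((e i).carrier ∪ (rhoPhi ct φ w (e j)).carrier) : RootSubsystem ct) =
      RootSubsystem.generate
        ((e i).carrier ∪ (rhoPhi ct φ (cs.simple i * w) (e j)).carrier)

/-- `Σ(Φ_U)_[e]`. -/
abbrev SigmaOrbit (ct : CoxeterSystem N U) (φ : W →* U) (e : B → RootSubsystem ct) :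
    Submonoid (RootSubsystem ct) :=
  orbitSubmonoid (rhoPhi ct φ) e

/-- The Marin datum `(R[Σ(Φ_U)_[e]], ρ_φ, ê)` of a Juyumaya map. -/
def juyumayaDatum {cs : CoxeterSystem M W} {ct : CoxeterSystem N U} {φ : W →* U}
    {e : B → RootSubsystem ct} (h : IsJuyumayaMap cs ct φ e) {R : Type*} [CommRing R]
    (u : B → Rˣ) (hu : IsEquivariant cs (fun _ r => r) u) :
    MarinDatum cs R (MonoidAlgebra R (SigmaOrbit ct φ e)) :=
  monoidDatum cs (orbitAction (rhoPhi ct φ) e) (orbitMap (rhoPhi ct φ) e)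
    (fun i => Subtype.ext (RootSubsystem.mul_self (e i)))
    (fun w i j hw => Subtype.ext (h.equivariant w i j hw)) u hu

end Juyumaya

end BraidsTies

end

open BraidsTies

/-!
The relations `e_s x = e_s (s.x)` hold for the generators `x = w.e_t` of `E_[e]` by assumption, and
extend to products because `e_s` is idempotent. They say that `1 - ê_s` is a multiple of `e_s` on
which `s` acts trivially.

By Matsumoto's theorem and the quadratic relations, the `g_w` span the Marin algebra. To see that
they are independent, let `W` index a basis of a free module, and write down the operators that
left and right multiplication by `g_s` have to be. Left operators commute with right ones, and the
right operators generate the module from the basis vector `1`, so the braid relations between the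
left operators need only be checked on that vector, where both sides are the same basis vector.
Evaluation at `1` then maps `g_w` to the basis vector `w`.

The augmentation is equivariant and maps `ê_s` to `u_s`, so it induces a homomorphism of Marin
algebras, which is onto because its image contains the coefficients and the braid group.
-/

noncomputable section

namespace BraidsTies

open CoxeterSystem

/-! ### The order of a product of two simple reflections -/

section Order

variable {B W : Type*} [Group W] {M : CoxeterMatrix B}

theorem geomForm_simpleReflection (i j : B) (v : B →₀ ℝ) :
    geomForm M (simpleRoot j) (simpleReflection M i v) = geomForm M (simpleRoot j) v +
      2 * Real.cos (Real.pi / (M i j : ℝ)) * geomForm M (simpleRoot i) v := by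
  rw [simpleReflection_apply, refl_apply, map_sub, map_smul, geomForm_simpleRoot, M.symmetric j i,
    smul_eq_mul]
  ring

theorem geomForm_simpleReflection_self (i : B) (v : B →₀ ℝ) :
    geomForm M (simpleRoot i) (simpleReflection M i v) = -geomForm M (simpleRoot i) v := by
  rw [geomForm_simpleReflection, M.diagonal, Nat.cast_one, div_one, Real.cos_pi]
  ring

variable (M) in
/-- The complex number `⟨αᵢ, v⟩ + ζ ⟨αⱼ, v⟩`. If `ζ = exp (π√-1 / mᵢⱼ)`, then it is a coordinate
in which the rotation `σᵢσⱼ` becomes the multiplication by `ζ²`. -/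
def rotationCoord (i j : B) (ζ : ℂ) (v : B →₀ ℝ) : ℂ :=
  geomForm M (simpleRoot i) v + ζ * geomForm M (simpleRoot j) v

theorem rotationCoord_simpleReflection {i j : B} {ζ : ℂ}
    (hζ : ζ ^ 2 + 1 = 2 * Real.cos (Real.pi / (M i j : ℝ)) * ζ) (v : B →₀ ℝ) :
    rotationCoord M i j ζ (simpleReflection M i v) = ζ * rotationCoord M j i ζ v := by
  rw [rotationCoord, rotationCoord, geomForm_simpleReflection_self, geomForm_simpleReflection]
  push_cast at hζ ⊢
  linear_combination (-(geomForm M (simpleRoot i) v : ℂ)) * hζ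

theorem rotationCoord_mul_pow {i j : B} {ζ : ℂ}
    (hζ : ζ ^ 2 + 1 = 2 * Real.cos (Real.pi / (M i j : ℝ)) * ζ) (k : ℕ) (v : B →₀ ℝ) :
    rotationCoord M i j ζ (((simpleReflection M i * simpleReflection M j) ^ k) v) =
      (ζ ^ 2) ^ k * rotationCoord M i j ζ v := by
  induction k with
  | zero => simp
  | succ k ih =>
    rw [pow_succ', LinearEquiv.mul_apply, LinearEquiv.mul_apply,
      rotationCoord_simpleReflection hζ, rotationCoord_simpleReflection (M.symmetric j i ▸ hζ), ih]
    ring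

theorem two_mul_rotationCoord_simpleRoot {i j : B} {ζ : ℂ}
    (hζ : ζ ^ 2 + 1 = 2 * Real.cos (Real.pi / (M i j : ℝ)) * ζ) :
    2 * rotationCoord M i j ζ (simpleRoot i) = 1 - ζ ^ 2 := by
  rw [rotationCoord, geomForm_simpleRoot, geomForm_simpleRoot, M.diagonal, M.symmetric j i,
    Nat.cast_one, div_one, Real.cos_pi]
  push_cast at hζ ⊢
  linear_combination hζ

theorem exp_pi_div_sq_add_one (m : ℕ) :
    Complex.exp (Real.pi * Complex.I / m) ^ 2 + 1 =
      2 * Real.cos (Real.pi / (m : ℝ)) * Complex.exp (Real.pi * Complex.I / m) := by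
  rw [Complex.ofReal_cos, Complex.two_cos, add_mul, ← Complex.exp_add, ← Complex.exp_add, sq,
    ← Complex.exp_add, ← Complex.exp_zero]
  push_cast
  ring_nf

theorem mul_pow_simpleRoot_of_eq_zero {i j : B} (hM : M i j = 0) (k : ℕ) :
    ((simpleReflection M i * simpleReflection M j) ^ k) (simpleRoot i) =
      simpleRoot i + (2 * k : ℝ) • (simpleRoot i + simpleRoot j) := by
  have hM' : M j i = 0 := M.symmetric j i ▸ hM
  induction k with
  | zero => simp
  | succ k ih =>
    rw [pow_succ', LinearEquiv.mul_apply, ih]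
    simp only [LinearEquiv.mul_apply, simpleReflection_apply, refl_apply, map_add, map_sub,
      map_smul, geomForm_simpleRoot, hM, hM', M.diagonal, Nat.cast_zero, div_zero, Real.cos_zero,
      Nat.cast_one, div_one, Real.cos_pi]
    push_cast
    module

variable (cs : CoxeterSystem M W)

theorem dvd_of_simple_mul_simple_pow_eq_one {i j : B} (hij : i ≠ j) {k : ℕ}
    (hk : (cs.simple i * cs.simple j) ^ k = 1) : M i j ∣ k := by
  have hfix : ((simpleReflection M i * simpleReflection M j) ^ k) (simpleRoot i) =
      simpleRoot i := by
    rw [← geomRep_simple cs, ← geomRep_simple cs, ← map_mul, ← map_pow, hk, map_one,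
      LinearEquiv.coe_one, id]
  obtain hM | hM := eq_or_ne (M i j) 0
  · rw [mul_pow_simpleRoot_of_eq_zero hM] at hfix
    have hj := DFunLike.congr_fun hfix j
    simp only [simpleRoot, Finsupp.add_apply, Finsupp.smul_apply, Finsupp.single_eq_same,
      Finsupp.single_eq_of_ne hij.symm, smul_eq_mul] at hj
    rw [hM, zero_dvd_iff]
    exact_mod_cast (by linarith : (k : ℝ) = 0)
  · set ζ := Complex.exp (Real.pi * Complex.I / M i j)
    have hζ : ζ ^ 2 + 1 = 2 * Real.cos (Real.pi / (M i j : ℝ)) * ζ := exp_pi_div_sq_add_one _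
    have hprim : IsPrimitiveRoot (ζ ^ 2) (M i j) := by
      convert Complex.isPrimitiveRoot_exp (M i j) hM using 1
      rw [sq, ← Complex.exp_add]
      ring_nf
    have hcoord : rotationCoord M i j ζ (simpleRoot i) ≠ 0 := by
      intro h
      have h1 := two_mul_rotationCoord_simpleRoot hζ
      rw [h, mul_zero, eq_comm, sub_eq_zero] at h1
      exact hprim.ne_one (by have := M.off_diagonal i j hij; omega) h1.symm
    have hrot := rotationCoord_mul_pow hζ k (simpleRoot i)
    rw [hfix, eq_comm, mul_eq_right₀ hcoord] at hrot
    exact hprim.dvd_of_pow_eq_one k hrot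

end Order

/-! ### The exchange condition -/

section Exchange

variable {B W : Type*} [Group W] {M : CoxeterMatrix B}

theorem prod_map_alternatingWord_two_mul {G : Type*} [Monoid G] (f : B → G) (i j : B) (n : ℕ) :
    ((alternatingWord i j (2 * n)).map f).prod = (f i * f j) ^ n := by
  induction n with
  | zero => simp [alternatingWord]
  | succ n ih => simp [Nat.mul_succ, alternatingWord_succ, ih, pow_succ]

variable (cs : CoxeterSystem M W)

theorem rightInvSeq_append (ω ω' : List B) :
    cs.rightInvSeq (ω ++ ω') =
      (cs.rightInvSeq ω).map (MulAut.conj (cs.wordProd ω')⁻¹) ++ cs.rightInvSeq ω' := by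
  induction ω with
  | nil => simp
  | cons i ω ih => simp [rightInvSeq, ih, wordProd_append, mul_assoc]

theorem rightInvSeq_alternatingWord (i j : B) (n : ℕ) :
    cs.rightInvSeq (alternatingWord i j n) =
      ((List.range n).map fun k => (cs.simple j * cs.simple i) ^ k * cs.simple j).reverse := by
  induction n generalizing i j with
  | zero => rfl
  | succ n ih =>
    have hconj (k : ℕ) :
        MulAut.conj (cs.simple j) ((cs.simple i * cs.simple j) ^ k * cs.simple i) =
          (cs.simple j * cs.simple i) ^ (k + 1) * cs.simple j := by
      rw [MulAut.conj_apply, inv_simple, pow_succ', mul_assoc (cs.simple j),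
        mul_assoc (cs.simple j), mul_assoc, ← mul_pow_mul]
      simp only [mul_assoc]
    rw [alternatingWord_succ, rightInvSeq_concat, ih, List.range_succ_eq_map]
    simp [hconj, Function.comp_def]

open Classical in
/-- The permutation of `W × ZMod 2` that conjugates the first component by `sᵢ` and changes the
second one if the first is `sᵢ`. Along a word it counts modulo `2` how often an element occurs in
the right inversion sequence. -/
def conjFlip (i : B) : Equiv.Perm (W × ZMod 2) :=
  Function.Involutive.toPerm
    (fun p => (cs.simple i * p.1 * cs.simple i, p.2 + if p.1 = cs.simple i then 1 else 0))
    fun p => by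
      have hconj : cs.simple i * p.1 * cs.simple i = cs.simple i ↔ p.1 = cs.simple i := by
        rw [mul_eq_right, mul_eq_one_iff_inv_eq, inv_simple, eq_comm]
      simp only [hconj, add_assoc, CharTwo.add_self_eq_zero, add_zero]
      simp only [mul_assoc, simple_mul_simple_cancel_left, simple_mul_simple_self, mul_one]

open Classical in
theorem conjFlip_apply (i : B) (p : W × ZMod 2) :
    conjFlip cs i p =
      (cs.simple i * p.1 * cs.simple i, p.2 + if p.1 = cs.simple i then 1 else 0) := rfl

open Classical in
theorem prod_map_conjFlip (ω : List B) (p : W × ZMod 2) :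
    (ω.map (conjFlip cs)).prod p =
      (cs.wordProd ω * p.1 * (cs.wordProd ω)⁻¹, p.2 + ((cs.rightInvSeq ω).count p.1 : ZMod 2)) := by
  induction ω with
  | nil => simp
  | cons i ω ih =>
    have hiff : (cs.wordProd ω)⁻¹ * cs.simple i * cs.wordProd ω = p.1 ↔
        cs.wordProd ω * p.1 * (cs.wordProd ω)⁻¹ = cs.simple i := by
      rw [mul_assoc, inv_mul_eq_iff_eq_mul, mul_inv_eq_iff_eq_mul, eq_comm]
    rw [List.map_cons, List.prod_cons, Equiv.Perm.mul_apply, ih]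
    simp only [conjFlip_apply, rightInvSeq, List.count_cons, wordProd_cons, mul_inv_rev, inv_simple,
      mul_assoc, beq_iff_eq, Nat.cast_add, Nat.cast_ite, Nat.cast_one, Nat.cast_zero, add_assoc]
    simp only [← mul_assoc, hiff]

theorem conjFlip_isLiftable : M.IsLiftable (conjFlip cs) := by
  classical
  intro i j
  have hprod : cs.wordProd (alternatingWord i j (2 * M i j)) = 1 := by
    rw [wordProd, prod_map_alternatingWord_two_mul, simple_mul_simple_pow]
  have hcount (t : W) :
      ((cs.rightInvSeq (alternatingWord i j (2 * M i j))).count t : ZMod 2) = 0 := by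
    rw [rightInvSeq_alternatingWord, List.count_reverse, two_mul, List.range_add, List.map_append,
      List.count_append, List.map_map]
    simp only [Function.comp_def, pow_add, simple_mul_simple_pow', one_mul]
    push_cast
    exact CharTwo.add_self_eq_zero _
  rw [← prod_map_alternatingWord_two_mul]
  ext1 p
  rw [prod_map_conjFlip, hprod, hcount]
  simp

open Classical in
theorem count_rightInvSeq_eq_of_wordProd_eq {ω ω' : List B} (h : cs.wordProd ω = cs.wordProd ω')
    (t : W) :
    ((cs.rightInvSeq ω).count t : ZMod 2) = ((cs.rightInvSeq ω').count t : ZMod 2) := by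
  have hlift (ω : List B) : cs.lift ⟨conjFlip cs, conjFlip_isLiftable cs⟩ (cs.wordProd ω) =
      (ω.map (conjFlip cs)).prod := by
    rw [wordProd, map_list_prod, List.map_map]
    exact congrArg (fun f => (ω.map f).prod)
      (funext (cs.lift_apply_simple (conjFlip_isLiftable cs)))
  have hflip : (ω.map (conjFlip cs)).prod (t, 0) = (ω'.map (conjFlip cs)).prod (t, 0) := by
    rw [← hlift, ← hlift, h]
  rw [prod_map_conjFlip, prod_map_conjFlip] at hflip
  simpa using congrArg Prod.snd hflip

variable {cs} in
theorem isRightDescent_of_simple_mem_rightInvSeq {ω : List B} {i : B} (hω : cs.IsReduced ω)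
    (h : cs.simple i ∈ cs.rightInvSeq ω) : cs.IsRightDescent (cs.wordProd ω) i :=
  (cs.isRightInversion_simple_iff_isRightDescent _ _).mp
    (cs.isRightInversion_of_mem_rightInvSeq hω h)

theorem simple_mem_rightInvSeq_of_isRightDescent {ω : List B} {i : B}
    (h : cs.IsRightDescent (cs.wordProd ω) i) : cs.simple i ∈ cs.rightInvSeq ω := by
  classical
  obtain ⟨ω', hω', hprod⟩ := cs.exists_isReduced (cs.wordProd ω * cs.simple i)
  have hnot : cs.simple i ∉ cs.rightInvSeq ω' := fun hmem =>
    cs.isRightDescent_iff_not_isRightDescent_mul.mp h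
      (hprod ▸ isRightDescent_of_simple_mem_rightInvSeq hω' hmem)
  have heq : cs.wordProd ω = cs.wordProd (ω' ++ [i]) := by
    rw [wordProd_append, wordProd_singleton, ← hprod, simple_mul_simple_cancel_right]
  have hnot' : cs.simple i ∉ (cs.rightInvSeq ω').map (MulAut.conj (cs.simple i)) := fun hmem =>
    hnot ((List.mem_map_of_injective (MulAut.conj (cs.simple i)).injective).mp
      (by simpa using hmem))
  have hpar := count_rightInvSeq_eq_of_wordProd_eq cs heq (cs.simple i)
  by_contra hc
  rw [List.count_eq_zero_of_not_mem hc, ← List.concat_eq_append, rightInvSeq_concat,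
    List.concat_eq_append, List.count_append, List.count_eq_zero_of_not_mem hnot'] at hpar
  simp at hpar

theorem isReduced_of_nodup_rightInvSeq {ω : List B} (h : (cs.rightInvSeq ω).Nodup) :
    cs.IsReduced ω := by
  classical
  obtain ⟨ω', hω', hprod⟩ := cs.exists_isReduced (cs.wordProd ω)
  have hsub : cs.rightInvSeq ω ⊆ cs.rightInvSeq ω' := by
    intro t ht
    have hpar := count_rightInvSeq_eq_of_wordProd_eq cs hprod t
    by_contra hc
    rw [List.count_eq_one_of_mem h ht, List.count_eq_zero_of_not_mem hc] at hpar
    simp at hpar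
  have hle := (h.subperm hsub).length_le
  rw [length_rightInvSeq, length_rightInvSeq, ← hω'.eq, ← hprod] at hle
  exact (cs.length_wordProd_le ω).antisymm hle

theorem isReduced_alternatingWord {i j : B} (hij : i ≠ j) {n : ℕ} (hn : M i j = 0 ∨ n ≤ M i j) :
    cs.IsReduced (alternatingWord i j n) := by
  refine isReduced_of_nodup_rightInvSeq cs ?_
  rw [rightInvSeq_alternatingWord, List.nodup_reverse]
  refine List.Nodup.map_on (fun a ha b hb hab => ?_) List.nodup_range
  wlog hle : a ≤ b generalizing a b
  · exact (this b hb a ha hab.symm (le_of_not_ge hle)).symm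
  obtain ⟨d, rfl⟩ := Nat.exists_eq_add_of_le hle
  have hd := mul_right_cancel hab
  rw [pow_add, left_eq_mul] at hd
  have hdvd : M i j ∣ d :=
    M.symmetric j i ▸ dvd_of_simple_mul_simple_pow_eq_one cs hij.symm hd
  obtain h0 | hle := hn
  · rw [h0, zero_dvd_iff] at hdvd
    rw [hdvd, add_zero]
  · have hb' := List.mem_range.mp hb
    rw [Nat.eq_zero_of_dvd_of_lt hdvd (by omega), add_zero]

variable {cs}

theorem simple_mul_eq_mul_simple {w : W} {i j : B} (hw : ¬cs.IsRightDescent w j)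
    (h : cs.IsRightDescent (cs.simple i * w) j) : cs.simple i * w = w * cs.simple j := by
  obtain ⟨ω, hω, rfl⟩ := cs.exists_isReduced w
  rw [← wordProd_cons] at h
  have hmem := simple_mem_rightInvSeq_of_isRightDescent cs h
  rw [rightInvSeq, List.mem_cons] at hmem
  obtain heq | hmem := hmem
  · rw [heq]
    group
  · exact absurd (isRightDescent_of_simple_mem_rightInvSeq hω hmem) hw

theorem isRightDescent_simple_mul_iff {w : W} {i j : B}
    (h : cs.simple i * w ≠ w * cs.simple j) :
    cs.IsRightDescent (cs.simple i * w) j ↔ cs.IsRightDescent w j := by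
  refine ⟨fun h₁ => by_contra fun h₂ => h (simple_mul_eq_mul_simple h₂ h₁), fun h₁ =>
    by_contra fun h₂ => h ?_⟩
  have hcomm := simple_mul_eq_mul_simple (i := i) h₂ (by rwa [simple_mul_simple_cancel_left])
  rw [simple_mul_simple_cancel_left] at hcomm
  nth_rw 2 [hcomm]
  rw [simple_mul_simple_cancel_right]

theorem isLeftDescent_mul_simple_iff {w : W} {i j : B}
    (h : cs.simple i * w ≠ w * cs.simple j) :
    cs.IsLeftDescent (w * cs.simple j) i ↔ cs.IsLeftDescent w i := by
  rw [← isRightDescent_inv_iff, ← isRightDescent_inv_iff, mul_inv_rev, inv_simple]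
  refine isRightDescent_simple_mul_iff fun hinv => h ?_
  simpa using (congrArg (·⁻¹) hinv).symm

end Exchange

/-! ### Matsumoto's theorem -/

section Matsumoto

variable {B W : Type*} [Group W] {M : CoxeterMatrix B} {cs : CoxeterSystem M W}

theorem isReduced_left_of_append {ω ω' : List B} (h : cs.IsReduced (ω ++ ω')) :
    cs.IsReduced ω := by
  simpa using h.take ω.length

theorem isRightDescent_of_isReduced_append_singleton {ω : List B} {i : B}
    (h : cs.IsReduced (ω ++ [i])) : cs.IsRightDescent (cs.wordProd (ω ++ [i])) i :=
  isRightDescent_of_simple_mem_rightInvSeq h (by simp [rightInvSeq_append])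

theorem exists_isReduced_append_alternatingWord {w : W} {i j : B} (hij : i ≠ j)
    (hi : cs.IsRightDescent w i) (hj : cs.IsRightDescent w j) (n : ℕ)
    (hn : M i j = 0 ∨ n ≤ M i j) :
    ∃ ν : List B, cs.IsReduced (ν ++ alternatingWord i j n) ∧
      w = cs.wordProd (ν ++ alternatingWord i j n) := by
  induction n generalizing i j with
  | zero => simpa [alternatingWord] using cs.exists_isReduced w
  | succ n ih =>
    obtain ⟨ν, hν, rfl⟩ := ih hij.symm hj hi (by rw [M.symmetric j i]; omega)
    have hred := isReduced_alternatingWord cs hij hn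
    have hsucc : alternatingWord i j (n + 1) = alternatingWord j i n ++ [j] := by
      rw [alternatingWord_succ, List.concat_eq_append]
    rw [hsucc] at hred ⊢
    have hmem := simple_mem_rightInvSeq_of_isRightDescent cs hj
    rw [rightInvSeq_append, List.mem_append, List.mem_map] at hmem
    obtain ⟨r, hr, hrj⟩ | hmem := hmem
    · have hν₀ := isReduced_left_of_append hν
      have hinv := cs.isRightInversion_of_mem_rightInvSeq hν₀ hr
      obtain ⟨ν', hν', hprod⟩ := cs.exists_isReduced (cs.wordProd ν * r)
      have hw : cs.wordProd (ν ++ alternatingWord j i n) =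
          cs.wordProd (ν' ++ (alternatingWord j i n ++ [j])) := by
        simp only [wordProd_append, wordProd_singleton, ← hprod, ← hrj, MulAut.conj_apply, inv_inv,
          mul_assoc, mul_inv_cancel_left]
        rw [← mul_assoc r r, hinv.1.mul_self, one_mul]
      refine ⟨ν', ?_, hw⟩
      have hlt := hinv.2
      rw [hprod, hν'.eq, hν₀.eq] at hlt
      refine (cs.length_wordProd_le _).antisymm ?_
      rw [← hw, hν.eq]
      simp only [List.length_append, List.length_singleton]
      omega
    · have hdesc := isRightDescent_of_isReduced_append_singleton hred
      rw [wordProd_append, wordProd_singleton, isRightDescent_iff_not_isRightDescent_mul,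
        simple_mul_simple_cancel_right] at hdesc
      exact absurd (isRightDescent_of_simple_mem_rightInvSeq
        (isReduced_alternatingWord cs hij.symm (by rw [M.symmetric j i]; omega)) hmem) hdesc

theorem exists_isReduced_append_braidWord {w : W} {i j : B} (hij : i ≠ j)
    (hi : cs.IsRightDescent w i) (hj : cs.IsRightDescent w j) :
    M i j ≠ 0 ∧ ∃ ν : List B, (cs.IsReduced (ν ++ braidWord M i j) ∧
      w = cs.wordProd (ν ++ braidWord M i j)) ∧ cs.IsReduced (ν ++ braidWord M j i) ∧
      w = cs.wordProd (ν ++ braidWord M j i) := by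
  refine ⟨fun hM => ?_, ?_⟩
  · obtain ⟨ν, hν, hw⟩ :=
      exists_isReduced_append_alternatingWord hij hi hj (cs.length w + 1) (Or.inl hM)
    have hlen := hν.eq
    rw [← hw, List.length_append, length_alternatingWord] at hlen
    omega
  · obtain ⟨ν, hν, hw⟩ := exists_isReduced_append_alternatingWord hij hi hj _ (Or.inr le_rfl)
    have hprod : cs.wordProd (ν ++ braidWord M j i) = cs.wordProd (ν ++ braidWord M i j) := by
      rw [wordProd_append, wordProd_append, wordProd_braidWord_eq]
    refine ⟨ν, ⟨hν, hw⟩, ?_, hw.trans hprod.symm⟩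
    rw [CoxeterSystem.IsReduced, hprod, braidWord, hν.eq]
    simp [M.symmetric j i]

theorem append_braidWord_eq {i j : B} {m : ℕ} (hm : M i j = m + 1) (ν : List B) :
    ν ++ braidWord M i j = (ν ++ alternatingWord j i m) ++ [j] := by
  rw [braidWord, hm, alternatingWord_succ, List.concat_eq_append, List.append_assoc]

theorem prod_map_eq_of_isReduced {G : Type*} [Monoid G] {f : B → G}
    (hf : ∀ i j, ((braidWord M i j).map f).prod = ((braidWord M j i).map f).prod)
    {ω ω' : List B} (hω : cs.IsReduced ω) (hω' : cs.IsReduced ω')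
    (h : cs.wordProd ω = cs.wordProd ω') : (ω.map f).prod = (ω'.map f).prod := by
  generalize hn : ω.length = n
  induction n generalizing ω ω' with
  | zero =>
    have hn' : ω'.length = 0 := by rw [← hω'.eq, ← h, hω.eq, hn]
    rw [List.length_eq_zero_iff.mp hn, List.length_eq_zero_iff.mp hn']
  | succ n ih =>
    have sameLast {α β : List B} {l : B} (hα : cs.IsReduced (α ++ [l]))
        (hβ : cs.IsReduced (β ++ [l]))
        (hαβ : cs.wordProd (α ++ [l]) = cs.wordProd (β ++ [l]))
        (hlen : (α ++ [l]).length = n + 1) :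
        ((α ++ [l]).map f).prod = ((β ++ [l]).map f).prod := by
      rw [wordProd_append, wordProd_append, mul_left_inj] at hαβ
      rw [List.map_append, List.map_append, List.prod_append, List.prod_append,
        ih (isReduced_left_of_append hα) (isReduced_left_of_append hβ) hαβ (by simpa using hlen)]
    have hn' : ω'.length = n + 1 := by rw [← hω'.eq, ← h, hω.eq, hn]
    obtain ⟨α, i, rfl⟩ := (List.eq_nil_or_concat' ω).resolve_left (by rintro rfl; simp at hn)
    obtain ⟨β, j, rfl⟩ := (List.eq_nil_or_concat' ω').resolve_left (by rintro rfl; simp at hn')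
    obtain rfl | hij := eq_or_ne i j
    · exact sameLast hω hω' h hn
    obtain ⟨hM, ν, ⟨hred, hw⟩, hred', hw'⟩ := exists_isReduced_append_braidWord hij
      (isRightDescent_of_isReduced_append_singleton hω)
      (h ▸ isRightDescent_of_isReduced_append_singleton hω')
    obtain ⟨m, hm⟩ := Nat.exists_eq_succ_of_ne_zero hM
    have hij := append_braidWord_eq hm ν
    have hji := append_braidWord_eq (M.symmetric i j ▸ hm) ν
    calc ((α ++ [i]).map f).prod = ((ν ++ braidWord M j i).map f).prod := by
          rw [hji] at hred' hw' ⊢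
          exact sameLast hω hred' hw' hn
      _ = ((ν ++ braidWord M i j).map f).prod := by
          rw [List.map_append, List.map_append, List.prod_append, List.prod_append, hf]
      _ = ((β ++ [j]).map f).prod := by
          rw [hij] at hred hw ⊢
          exact (sameLast hω' hred (h.symm.trans hw) hn').symm

end Matsumoto

namespace MarinDatum

/-! ### The operators of left and right multiplication -/

section Operators

variable {B W : Type*} [Group W] {M : CoxeterMatrix B} {cs : CoxeterSystem M W}
  {k A : Type*} [CommRing k] [CommRing A] [Algebra k A] (D : MarinDatum cs k A)

/-- The action of `W` on the coefficients. -/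
def act (w : W) : D.Coeff ≃ₐ[k] D.Coeff :=
  (D.toCoeff.symm.trans (D.ρ w)).trans D.toCoeff

/-- The parameter `a_s` as a coefficient. -/
def param (i : B) : D.Coeff := D.toCoeff (D.a i)

theorem smul_eq_act (x : ArtinGroup M) (c : D.Coeff) : x • c = D.act (artinProj cs x) c := rfl

theorem act_one (c : D.Coeff) : D.act 1 c = c := by simp [act]

theorem act_mul (w w' : W) (c : D.Coeff) : D.act (w * w') c = D.act w (D.act w' c) := by
  simp [act]

theorem act_simple_act_simple (i : B) (c : D.Coeff) :
    D.act (cs.simple i) (D.act (cs.simple i) c) = c := by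
  rw [← act_mul, simple_mul_simple_self, act_one]

theorem act_param {w : W} {i j : B} (h : w * cs.simple i * w⁻¹ = cs.simple j) :
    D.act w (D.param i) = D.param j := by
  simpa [act, param] using congrArg Units.val (D.equivariant w i j h)

theorem act_simple_param (i : B) : D.act (cs.simple i) (D.param i) = D.param i :=
  D.act_param (by simp)

theorem isUnit_param (i : B) : IsUnit (D.param i) :=
  (D.a i).isUnit.map D.toCoeff

/-- The condition `(1 - a_s) (s.c) = (1 - a_s) c` on the coefficients `c`, under which the elements
`g_w` form a basis of the Marin algebra. -/
def IsCompatible : Prop :=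
  ∀ (i : B) (c : D.Coeff), (1 - D.param i) * D.act (cs.simple i) c = (1 - D.param i) * c

open Classical in
/-- The coefficient of `g_{sw}` in `g_s g_w`; that of `g_w` is the difference from `1`. -/
def leftWeight (i : B) (w : W) : D.Coeff := if cs.IsLeftDescent w i then D.param i else 1

open Classical in
/-- The coefficient of `g_{ws}` in `g_w g_s`; that of `g_w` is the difference from `1`. -/
def rightWeight (w : W) (j : B) : D.Coeff :=
  if cs.IsRightDescent w j then D.act w (D.param j) else 1

/-- Left multiplication by `g_s` on the free module with basis `W`. -/
def leftOp (i : B) : Module.End k (W →₀ D.Coeff) :=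
  Finsupp.lsum k fun w =>
    ((Finsupp.lsingle (cs.simple i * w)).comp (LinearMap.mulLeft k (D.leftWeight i w)) +
      (Finsupp.lsingle w).comp (LinearMap.mulLeft k (1 - D.leftWeight i w))).comp
        (D.act (cs.simple i)).toLinearMap

/-- Right multiplication by `g_s` on the free module with basis `W`. -/
def rightOp (j : B) : Module.End k (W →₀ D.Coeff) :=
  Finsupp.lsum k fun w =>
    (Finsupp.lsingle (w * cs.simple j)).comp (LinearMap.mulLeft k (D.rightWeight w j)) +
      (Finsupp.lsingle w).comp (LinearMap.mulLeft k (1 - D.rightWeight w j))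

theorem leftOp_single (i : B) (w : W) (c : D.Coeff) :
    D.leftOp i (Finsupp.single w c) =
      Finsupp.single (cs.simple i * w) (D.leftWeight i w * D.act (cs.simple i) c) +
        Finsupp.single w ((1 - D.leftWeight i w) * D.act (cs.simple i) c) := by
  simp [leftOp]

theorem rightOp_single (j : B) (w : W) (c : D.Coeff) :
    D.rightOp j (Finsupp.single w c) =
      Finsupp.single (w * cs.simple j) (D.rightWeight w j * c) +
        Finsupp.single w ((1 - D.rightWeight w j) * c) := by
  simp [rightOp]

theorem leftOp_single_of_not_isLeftDescent {w : W} {i : B} (h : ¬cs.IsLeftDescent w i)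
    (c : D.Coeff) :
    D.leftOp i (Finsupp.single w c) =
      Finsupp.single (cs.simple i * w) (D.act (cs.simple i) c) := by
  simp [leftOp_single, leftWeight, h]

theorem rightOp_single_of_not_isRightDescent {w : W} {j : B} (h : ¬cs.IsRightDescent w j)
    (c : D.Coeff) :
    D.rightOp j (Finsupp.single w c) = Finsupp.single (w * cs.simple j) c := by
  simp [rightOp_single, rightWeight, h]

theorem leftOp_smul (i : B) (c : D.Coeff) (x : W →₀ D.Coeff) :
    D.leftOp i (c • x) = D.act (cs.simple i) c • D.leftOp i x := by
  induction x using Finsupp.induction_linear with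
  | zero => simp
  | add x y hx hy => simp only [smul_add, map_add, hx, hy]
  | single w d =>
    simp only [Finsupp.smul_single, smul_eq_mul, leftOp_single, map_mul, smul_add, mul_left_comm]

theorem leftWeight_add_leftWeight (i : B) (w : W) :
    D.leftWeight i w + D.leftWeight i (cs.simple i * w) = 1 + D.param i := by
  have h := cs.isLeftDescent_iff_not_isLeftDescent_mul (w := w) (i := i)
  by_cases hw : cs.IsLeftDescent w i
  · simp [leftWeight, hw, h.mp hw, add_comm]
  · simp [leftWeight, hw, not_not.mp (mt h.mpr hw)]

theorem act_simple_leftWeight (i : B) (w : W) :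
    D.act (cs.simple i) (D.leftWeight i w) = D.leftWeight i w := by
  unfold leftWeight
  split_ifs <;> simp [act_simple_param]

variable {D}

theorem one_sub_leftWeight_mul_act (hD : D.IsCompatible) (i : B) (w : W) (c : D.Coeff) :
    (1 - D.leftWeight i w) * D.act (cs.simple i) c = (1 - D.leftWeight i w) * c := by
  unfold leftWeight
  split_ifs
  · exact hD i c
  · simp

theorem leftOp_leftOp (hD : D.IsCompatible) (i : B) (x : W →₀ D.Coeff) :
    D.leftOp i (D.leftOp i x) = D.param i • x + (1 - D.param i) • D.leftOp i x := by
  induction x using Finsupp.induction_linear with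
  | zero => simp
  | add x y hx hy => simp only [map_add, smul_add, hx, hy]; abel
  | single w c =>
    have hadd := D.leftWeight_add_leftWeight i w
    have hact := one_sub_leftWeight_mul_act hD i w c
    simp only [leftOp_single, map_add, simple_mul_simple_cancel_left, map_mul, map_sub, map_one,
      act_simple_leftWeight, act_simple_act_simple, smul_add, Finsupp.smul_single, smul_eq_mul]
    set p := D.leftWeight i w
    set q := D.leftWeight i (cs.simple i * w)
    set c' := D.act (cs.simple i) c
    have hw : q * (p * c) + (1 - p) * ((1 - p) * c) =
        D.param i * c + (1 - D.param i) * ((1 - p) * c') := by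
      linear_combination (D.param i - 1) * hact + c * p * hadd
    have hsw : (1 - q) * (p * c) + p * ((1 - p) * c) = (1 - D.param i) * (p * c') := by
      linear_combination -p * hD i c - p * c * hadd
    have hw' := congrArg (Finsupp.single w) hw
    have hsw' := congrArg (Finsupp.single (cs.simple i * w)) hsw
    simp only [Finsupp.single_add] at hw' hsw'
    rw [add_left_comm (Finsupp.single w (D.param i * c)), ← hw', ← hsw']
    abel

theorem leftWeight_mul_simple {w : W} {i j : B} (h : cs.simple i * w ≠ w * cs.simple j) :
    D.leftWeight i (w * cs.simple j) = D.leftWeight i w := by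
  rw [leftWeight, leftWeight, isLeftDescent_mul_simple_iff h]

theorem rightWeight_simple_mul {w : W} {i j : B} (h : cs.simple i * w ≠ w * cs.simple j) :
    D.rightWeight (cs.simple i * w) j = D.act (cs.simple i) (D.rightWeight w j) := by
  rw [rightWeight, rightWeight, isRightDescent_simple_mul_iff h]
  split_ifs <;> simp [act_mul]

theorem leftOp_rightOp_single_of_ne (hD : D.IsCompatible) {w : W} {i j : B}
    (h : cs.simple i * w ≠ w * cs.simple j) (c : D.Coeff) :
    D.leftOp i (D.rightOp j (Finsupp.single w c)) =
      D.rightOp j (D.leftOp i (Finsupp.single w c)) := by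
  simp only [leftOp_single, rightOp_single, map_add, leftWeight_mul_simple h,
    rightWeight_simple_mul h, map_mul, map_sub, map_one, mul_assoc,
    mul_left_comm (D.leftWeight i w)]
  have hact := one_sub_leftWeight_mul_act hD i w (D.rightWeight w j)
  set p := D.leftWeight i w
  set r := D.rightWeight w j
  set c' := D.act (cs.simple i) c
  have hwj : (1 - p) * (D.act (cs.simple i) r * c') = r * ((1 - p) * c') := by
    linear_combination c' * hact
  have hw : (1 - p) * ((1 - D.act (cs.simple i) r) * c') = (1 - r) * ((1 - p) * c') := by
    linear_combination -c' * hact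
  rw [hwj, hw, add_add_add_comm]

theorem leftWeight_eq_rightWeight {w : W} {i j : B} (h : cs.simple i * w = w * cs.simple j) :
    D.leftWeight i w = D.rightWeight w j := by
  have hp : D.act w (D.param j) = D.param i := D.act_param (by simp [← h])
  simp only [leftWeight, rightWeight, IsLeftDescent, IsRightDescent, h, hp]

theorem rightOp_single_eq_leftOp_single {w : W} {i j : B}
    (h : cs.simple i * w = w * cs.simple j) (c : D.Coeff) :
    D.rightOp j (Finsupp.single w c) =
      D.leftOp i (Finsupp.single w (D.act (cs.simple i) c)) := by
  rw [leftOp_single, rightOp_single, h, leftWeight_eq_rightWeight h, act_simple_act_simple]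

theorem leftOp_rightOp_single_of_eq {w : W} {i j : B}
    (h : cs.simple i * w = w * cs.simple j) (c : D.Coeff) :
    D.leftOp i (D.rightOp j (Finsupp.single w c)) =
      D.rightOp j (D.leftOp i (Finsupp.single w c)) := by
  have h' : cs.simple i * (cs.simple i * w) = cs.simple i * w * cs.simple j := by
    rw [h, ← mul_assoc, h]
  rw [rightOp_single_eq_leftOp_single h, leftOp_single, leftOp_single, map_add (D.rightOp j),
    rightOp_single_eq_leftOp_single h, rightOp_single_eq_leftOp_single h', map_add]
  simp only [map_mul, map_sub, map_one, act_simple_leftWeight]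

theorem leftOp_rightOp (hD : D.IsCompatible) (i j : B) (x : W →₀ D.Coeff) :
    D.leftOp i (D.rightOp j x) = D.rightOp j (D.leftOp i x) := by
  induction x using Finsupp.induction_linear with
  | zero => simp
  | add x y hx hy => simp only [map_add, hx, hy]
  | single w c =>
    by_cases h : cs.simple i * w = w * cs.simple j
    · exact leftOp_rightOp_single_of_eq h c
    · exact leftOp_rightOp_single_of_ne hD h c

theorem prod_leftOp_smul (ω : List B) (c : D.Coeff) (x : W →₀ D.Coeff) :
    (ω.map D.leftOp).prod (c • x) = D.act (cs.wordProd ω) c • (ω.map D.leftOp).prod x := by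
  induction ω with
  | nil => simp [act_one]
  | cons i ω ih => simp [ih, leftOp_smul, wordProd_cons, act_mul]

theorem prod_leftOp_rightOp (hD : D.IsCompatible) (ω : List B) (j : B) (x : W →₀ D.Coeff) :
    (ω.map D.leftOp).prod (D.rightOp j x) = D.rightOp j ((ω.map D.leftOp).prod x) := by
  induction ω with
  | nil => simp
  | cons i ω ih => simp [ih, leftOp_rightOp hD]

theorem prod_leftOp_single_one {ω : List B} (hω : cs.IsReduced ω) :
    (ω.map D.leftOp).prod (Finsupp.single 1 1) = Finsupp.single (cs.wordProd ω) 1 := by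
  induction ω with
  | nil => simp
  | cons i ω ih =>
    have hred : cs.IsReduced ω := hω.drop 1
    have h : ¬cs.IsLeftDescent (cs.wordProd ω) i := by
      rw [not_isLeftDescent_iff, ← wordProd_cons, hω.eq, hred.eq, List.length_cons]
    rw [List.map_cons, List.prod_cons, Module.End.mul_apply, ih hred,
      leftOp_single_of_not_isLeftDescent D h, map_one, wordProd_cons]

/-- The right operators generate the module from the basis vector `1` and commute with the left
ones. -/
theorem prod_leftOp_ext (hD : D.IsCompatible) {ω ω' : List B}
    (h : cs.wordProd ω = cs.wordProd ω')
    (h1 : (ω.map D.leftOp).prod (Finsupp.single 1 1) =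
      (ω'.map D.leftOp).prod (Finsupp.single 1 1)) :
    (ω.map D.leftOp).prod = (ω'.map D.leftOp).prod := by
  have hw (w : W) : (ω.map D.leftOp).prod (Finsupp.single w 1) =
      (ω'.map D.leftOp).prod (Finsupp.single w 1) := by
    obtain ⟨ν, hν, rfl⟩ := cs.exists_isReduced w
    induction ν using List.reverseRecOn with
    | nil => simpa using h1
    | append_singleton ν j ih =>
      have hred : cs.IsReduced ν := isReduced_left_of_append hν
      have hd : ¬cs.IsRightDescent (cs.wordProd ν) j := by
        rw [not_isRightDescent_iff, ← wordProd_concat, List.concat_eq_append, hν.eq, hred.eq,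
          List.length_append, List.length_singleton]
      have hs : Finsupp.single (cs.wordProd (ν ++ [j])) 1 =
          D.rightOp j (Finsupp.single (cs.wordProd ν) 1) := by
        rw [rightOp_single_of_not_isRightDescent D hd, ← wordProd_concat, List.concat_eq_append]
      rw [hs, prod_leftOp_rightOp hD, prod_leftOp_rightOp hD, ih hred]
  refine Finsupp.lhom_ext fun w c => ?_
  have hc : Finsupp.single w c = c • Finsupp.single w (1 : D.Coeff) := by simp
  rw [hc, prod_leftOp_smul, prod_leftOp_smul, hw, h]

theorem prod_leftOp_braidWord (hD : D.IsCompatible) (i j : B) :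
    ((braidWord M i j).map D.leftOp).prod = ((braidWord M j i).map D.leftOp).prod := by
  rcases eq_or_ne i j with rfl | hij
  · rfl
  have hred := isReduced_alternatingWord cs hij (Or.inr le_rfl)
  have hred' := isReduced_alternatingWord cs hij.symm (Or.inr le_rfl)
  refine prod_leftOp_ext hD (cs.wordProd_braidWord_eq i j) ?_
  rw [braidWord, braidWord, prod_leftOp_single_one hred, prod_leftOp_single_one hred']
  exact congrArg (Finsupp.single · 1) (cs.wordProd_braidWord_eq i j)

end Operators

end MarinDatum

/-! ### Words in the Artin group -/

section ArtinWord

variable {B W : Type*} [Group W] {M : CoxeterMatrix B}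

theorem artinWord_cons (i : B) (ω : List B) :
    artinWord M (i :: ω) = PresentedGroup.of i * artinWord M ω := by
  simp [artinWord]

theorem prod_map_of_braidWord (i j : B) :
    ((braidWord M i j).map fun i => (PresentedGroup.of i : ArtinGroup M)).prod =
      ((braidWord M j i).map fun i => (PresentedGroup.of i : ArtinGroup M)).prod := by
  have h := PresentedGroup.mk_eq_mk_of_mul_inv_mem (rels := artinRelations M) ⟨i, j, rfl⟩
  rwa [map_list_prod, map_list_prod, List.map_map, List.map_map] at h

theorem artinWord_eq_of_isReduced {cs : CoxeterSystem M W} {ω ω' : List B}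
    (hω : cs.IsReduced ω) (hω' : cs.IsReduced ω') (h : cs.wordProd ω = cs.wordProd ω') :
    artinWord M ω = artinWord M ω' :=
  prod_map_eq_of_isReduced prod_map_of_braidWord hω hω' h

theorem artinProj_of (cs : CoxeterSystem M W) (i : B) :
    artinProj cs (PresentedGroup.of i) = cs.simple i := by
  simp [artinProj]

end ArtinWord

/-! ### The Marin algebra and its standard basis -/

theorem isUnit_of_mul_self_eq {C : Type*} [Ring C] {a g : C} (ha : IsUnit a)
    (hcomm : Commute a g) (h : g * g = a + (1 - a) * g) : IsUnit g := by
  have hfactor : g * (g - (1 - a)) = a := by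
    rw [mul_sub, h, ← ((Commute.one_left g).sub_left hcomm).eq, add_sub_cancel_right]
  have hcomm' : Commute g (g - (1 - a)) :=
    (Commute.refl g).sub_right ((Commute.one_right g).sub_right hcomm.symm)
  exact (hcomm'.isUnit_mul_iff.mp (by rwa [hfactor])).1

namespace MarinDatum

section Algebra

variable {B W : Type*} [Group W] {M : CoxeterMatrix B} {cs : CoxeterSystem M W}
  {k A : Type*} [CommRing k] [CommRing A] [Algebra k A] (D : MarinDatum cs k A)

theorem coeff_smul_def (c : D.Coeff) (x : D.MarinAlgebra) : c • x = D.coeffHom c * x := rfl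

theorem quotientMap_single (g : ArtinGroup M) (c : D.Coeff) :
    D.quotientMap (SkewMonoidAlgebra.single g c) = c • D.gen g := by
  rw [coeff_smul_def]
  change _ = D.quotientMap (SkewMonoidAlgebra.single 1 c) *
    D.quotientMap (SkewMonoidAlgebra.single g 1)
  rw [← map_mul, SkewMonoidAlgebra.single_mul_single]
  simp

theorem quotientMap_surjective : Function.Surjective D.quotientMap :=
  RingQuot.mkAlgHom_surjective k D.Rel

theorem coeffHom_smul_mul_gen (g : ArtinGroup M) (c : D.Coeff) :
    D.coeffHom (g • c) * D.gen g = D.gen g * D.coeffHom c := by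
  change D.quotientMap (SkewMonoidAlgebra.single 1 (g • c)) *
      D.quotientMap (SkewMonoidAlgebra.single g 1) =
    D.quotientMap (SkewMonoidAlgebra.single g 1) * D.quotientMap (SkewMonoidAlgebra.single 1 c)
  rw [← map_mul, ← map_mul, SkewMonoidAlgebra.single_mul_single,
    SkewMonoidAlgebra.single_mul_single]
  simp

theorem gen_of_mul_gen_of (i : B) :
    D.gen (PresentedGroup.of i) * D.gen (PresentedGroup.of i) =
      D.coeffHom (D.param i) + D.coeffHom (1 - D.param i) * D.gen (PresentedGroup.of i) := by
  have h := RingQuot.mkAlgHom_rel k (Rel.quadratic (D := D) i)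
  change D.quotientMap _ = D.quotientMap _ at h
  rw [sq, map_mul, map_add, map_mul] at h
  exact h

theorem gen_mul_smul (g : ArtinGroup M) (c : D.Coeff) (x : D.MarinAlgebra) :
    D.gen g * c • x = (g • c) • (D.gen g * x) := by
  rw [coeff_smul_def, coeff_smul_def, ← mul_assoc, ← mul_assoc, coeffHom_smul_mul_gen]

theorem gen_of_mul_gen_of_mul (i : B) (x : D.MarinAlgebra) :
    D.gen (PresentedGroup.of i) * (D.gen (PresentedGroup.of i) * x) =
      D.param i • x + (1 - D.param i) • (D.gen (PresentedGroup.of i) * x) := by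
  rw [← mul_assoc, gen_of_mul_gen_of, add_mul, mul_assoc, coeff_smul_def, coeff_smul_def]

/-- The universal property of the Marin algebra: a homomorphism out of it is given by its
restrictions to `A` and to the Artin group. -/
def liftHom {C : Type*} [Ring C] [Algebra k C] (f : D.Coeff →ₐ[k] C) (g : ArtinGroup M →* C)
    (hcomm : ∀ x c, f (x • c) * g x = g x * f c)
    (hquad : ∀ i, g (PresentedGroup.of i) * g (PresentedGroup.of i) =
      f (D.param i) + f (1 - D.param i) * g (PresentedGroup.of i)) : D.MarinAlgebra →ₐ[k] C :=
  RingQuot.liftAlgHom k ⟨SkewMonoidAlgebra.liftNCAlgHom f g (fun {c x} => hcomm x c), by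
    rintro _ _ ⟨i⟩
    have h (x : ArtinGroup M) (c : D.Coeff) :
        SkewMonoidAlgebra.liftNCAlgHom f g (fun {c x} => hcomm x c)
          (SkewMonoidAlgebra.single x c) = f c * g x :=
      SkewMonoidAlgebra.liftNC_single _ _ _ _
    rw [map_pow, map_add, map_mul, h, h, h, map_one, map_one, one_mul, mul_one, mul_one, sq]
    exact hquad i⟩

section liftHom

variable {C : Type*} [Ring C] [Algebra k C] (f : D.Coeff →ₐ[k] C) (g : ArtinGroup M →* C)
  (hcomm : ∀ x c, f (x • c) * g x = g x * f c)
  (hquad : ∀ i, g (PresentedGroup.of i) * g (PresentedGroup.of i) =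
    f (D.param i) + f (1 - D.param i) * g (PresentedGroup.of i))

theorem liftHom_quotientMap_single (x : ArtinGroup M) (c : D.Coeff) :
    D.liftHom f g hcomm hquad (D.quotientMap (SkewMonoidAlgebra.single x c)) = f c * g x :=
  (RingQuot.liftAlgHom_mkAlgHom_apply k _ _ _).trans (SkewMonoidAlgebra.liftNC_single _ _ _ _)

theorem liftHom_coeffHom (c : D.Coeff) : D.liftHom f g hcomm hquad (D.coeffHom c) = f c := by
  refine (liftHom_quotientMap_single D f g hcomm hquad 1 c).trans ?_
  rw [map_one, mul_one]

theorem liftHom_gen (x : ArtinGroup M) : D.liftHom f g hcomm hquad (D.gen x) = g x := by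
  refine (liftHom_quotientMap_single D f g hcomm hquad x 1).trans ?_
  rw [map_one, one_mul]

end liftHom

variable {D}

theorem isUnit_leftOp (hD : D.IsCompatible) (i : B) : IsUnit (D.leftOp i) := by
  let param : Module.End k (W →₀ D.Coeff) := Algebra.lsmul k k (W →₀ D.Coeff) (D.param i)
  have hcomm : Commute param (D.leftOp i) := by
    refine LinearMap.ext fun x => (?_ : D.param i • D.leftOp i x = D.leftOp i (D.param i • x))
    rw [leftOp_smul, act_simple_param]
  have hunit : IsUnit param := (D.isUnit_param i).map _
  refine isUnit_of_mul_self_eq (C := Module.End k (W →₀ D.Coeff)) hunit hcomm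
    (LinearMap.ext fun x => ?_)
  simpa [param, sub_smul] using leftOp_leftOp hD i x

/-- The operator `leftOp i` as a unit of the endomorphism ring. -/
def leftUnit (hD : D.IsCompatible) (i : B) : (Module.End k (W →₀ D.Coeff))ˣ :=
  (isUnit_leftOp hD i).unit

theorem coe_prod_map_leftUnit (hD : D.IsCompatible) (ω : List B) :
    ((ω.map (leftUnit hD)).prod : Module.End k (W →₀ D.Coeff)) = (ω.map D.leftOp).prod := by
  induction ω with
  | nil => simp
  | cons i ω ih => simp [ih, leftUnit]

theorem prod_leftUnit_braidWord (hD : D.IsCompatible) (i j : B) :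
    ((braidWord M i j).map (leftUnit hD)).prod = ((braidWord M j i).map (leftUnit hD)).prod :=
  Units.ext (by rw [coe_prod_map_leftUnit, coe_prod_map_leftUnit, prod_leftOp_braidWord hD])

/-- The action of the Artin group on the free module with basis `W`. -/
def artinRep (hD : D.IsCompatible) : ArtinGroup M →* Module.End k (W →₀ D.Coeff) :=
  (Units.coeHom _).comp (PresentedGroup.toGroup (f := leftUnit hD) (by
    rintro _ ⟨i, j, rfl⟩
    simpa [map_list_prod, mul_inv_eq_one, Function.comp_def] using
      prod_leftUnit_braidWord hD i j))

theorem artinRep_of (hD : D.IsCompatible) (i : B) :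
    artinRep hD (PresentedGroup.of i) = D.leftOp i := by
  simp [artinRep, leftUnit]

theorem artinRep_smul (hD : D.IsCompatible) (g : ArtinGroup M) (c : D.Coeff)
    (x : W →₀ D.Coeff) :
    artinRep hD g (c • x) = (g • c) • artinRep hD g x := by
  have hg : g ∈ Subgroup.closure (Set.range (PresentedGroup.of (rels := artinRelations M))) := by
    simp
  induction hg using Subgroup.closure_induction generalizing c x with
  | mem g hg =>
    obtain ⟨i, rfl⟩ := hg
    rw [artinRep_of, leftOp_smul, smul_eq_act, artinProj_of]
  | one => simp
  | mul g h _ _ hg hh => rw [map_mul, Module.End.mul_apply, hh, hg, mul_smul]; rfl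
  | inv g _ hg =>
    have hcancel (y : W →₀ D.Coeff) : artinRep hD g (artinRep hD g⁻¹ y) = y := by
      rw [← Module.End.mul_apply, ← map_mul]; simp
    have hcancel' (y : W →₀ D.Coeff) : artinRep hD g⁻¹ (artinRep hD g y) = y := by
      rw [← Module.End.mul_apply, ← map_mul]; simp
    conv_lhs => rw [← hcancel x, ← smul_inv_smul g c]
    rw [← hg, hcancel']

theorem artinRep_artinWord (hD : D.IsCompatible) (ω : List B) :
    artinRep hD (artinWord M ω) = (ω.map D.leftOp).prod := by
  rw [artinWord, map_list_prod, List.map_map]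
  exact congrArg List.prod (List.map_congr_left fun i _ => artinRep_of hD i)

theorem lsmul_mul_artinRep (hD : D.IsCompatible) (g : ArtinGroup M) (c : D.Coeff) :
    Algebra.lsmul k k (W →₀ D.Coeff) (g • c) * artinRep hD g =
      artinRep hD g * Algebra.lsmul k k (W →₀ D.Coeff) c :=
  LinearMap.ext fun x => (artinRep_smul hD g c x).symm

theorem artinRep_of_mul_self (hD : D.IsCompatible) (i : B) :
    artinRep hD (PresentedGroup.of i) * artinRep hD (PresentedGroup.of i) =
      Algebra.lsmul k k (W →₀ D.Coeff) (D.param i) +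
        Algebra.lsmul k k (W →₀ D.Coeff) (1 - D.param i) *
          artinRep hD (PresentedGroup.of i) := by
  rw [artinRep_of]
  exact LinearMap.ext fun x => leftOp_leftOp hD i x

/-- The regular representation of the Marin algebra on the free module with basis `W`. -/
def regularRep (hD : D.IsCompatible) : D.MarinAlgebra →ₐ[k] Module.End k (W →₀ D.Coeff) :=
  D.liftHom (C := Module.End k (W →₀ D.Coeff)) (Algebra.lsmul k k (W →₀ D.Coeff)) (artinRep hD)
    (lsmul_mul_artinRep hD) (artinRep_of_mul_self hD)

variable (D) in
/-- The element `g_w` of the Marin algebra. -/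
def genWord (w : W) : D.MarinAlgebra := D.gen (artinWord M (cs.exists_isReduced w).choose)

theorem genWord_wordProd {ω : List B} (hω : cs.IsReduced ω) :
    D.genWord (cs.wordProd ω) = D.gen (artinWord M ω) := by
  have h := (cs.exists_isReduced (cs.wordProd ω)).choose_spec
  rw [genWord, artinWord_eq_of_isReduced h.1 hω h.2.symm]

theorem gen_of_mul_genWord {w : W} {i : B} (h : ¬cs.IsLeftDescent w i) :
    D.gen (PresentedGroup.of i) * D.genWord w = D.genWord (cs.simple i * w) := by
  obtain ⟨ω, hω, rfl⟩ := cs.exists_isReduced w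
  have hred : cs.IsReduced (i :: ω) := by
    rw [CoxeterSystem.IsReduced, wordProd_cons, cs.not_isLeftDescent_iff.mp h, hω.eq,
      List.length_cons]
  rw [← wordProd_cons, genWord_wordProd hω, genWord_wordProd hred, artinWord_cons, map_mul]

theorem gen_of_mul_mem_span (i : B) {x : D.MarinAlgebra}
    (hx : x ∈ Submodule.span D.Coeff (Set.range D.genWord)) :
    D.gen (PresentedGroup.of i) * x ∈ Submodule.span D.Coeff (Set.range D.genWord) := by
  induction hx using Submodule.span_induction with
  | mem x hx =>
    obtain ⟨w, rfl⟩ := hx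
    by_cases h : cs.IsLeftDescent w i
    · have h' : ¬cs.IsLeftDescent (cs.simple i * w) i := by
        rw [IsLeftDescent, simple_mul_simple_cancel_left]; exact lt_asymm h
      have hw := gen_of_mul_genWord (D := D) h'
      rw [simple_mul_simple_cancel_left] at hw
      rw [← hw, gen_of_mul_gen_of_mul, hw]
      exact add_mem (Submodule.smul_mem _ _ (Submodule.subset_span ⟨_, rfl⟩))
        (Submodule.smul_mem _ _ (Submodule.subset_span ⟨_, rfl⟩))
    · rw [gen_of_mul_genWord h]
      exact Submodule.subset_span ⟨_, rfl⟩
  | zero => simp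
  | add x y _ _ hx hy => rw [mul_add]; exact add_mem hx hy
  | smul c x _ hx => rw [gen_mul_smul]; exact Submodule.smul_mem _ _ hx

theorem gen_of_inv_mul_mem_span (i : B) {x : D.MarinAlgebra}
    (hx : x ∈ Submodule.span D.Coeff (Set.range D.genWord)) :
    D.gen (PresentedGroup.of i)⁻¹ * x ∈ Submodule.span D.Coeff (Set.range D.genWord) := by
  have hcancel : D.gen (PresentedGroup.of i) * (D.gen (PresentedGroup.of i)⁻¹ * x) = x := by
    rw [← mul_assoc, ← map_mul, mul_inv_cancel, map_one, one_mul]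
  have hquad := D.gen_of_mul_gen_of_mul i (D.gen (PresentedGroup.of i)⁻¹ * x)
  rw [hcancel, ← sub_eq_iff_eq_add] at hquad
  rw [← Submodule.smul_mem_iff_of_isUnit _ (D.isUnit_param i), ← hquad]
  exact sub_mem (gen_of_mul_mem_span i hx) (Submodule.smul_mem _ _ hx)

theorem gen_mul_mem_span (g : ArtinGroup M) {x : D.MarinAlgebra}
    (hx : x ∈ Submodule.span D.Coeff (Set.range D.genWord)) :
    D.gen g * x ∈ Submodule.span D.Coeff (Set.range D.genWord) := by
  have hg : g ∈ Subgroup.closure (Set.range (PresentedGroup.of (rels := artinRelations M))) := by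
    simp
  induction hg using Subgroup.closure_induction'' generalizing x with
  | mem _ hi =>
    obtain ⟨i, rfl⟩ := hi
    exact gen_of_mul_mem_span i hx
  | inv_mem _ hi =>
    obtain ⟨i, rfl⟩ := hi
    exact gen_of_inv_mul_mem_span i hx
  | one => simpa using hx
  | mul g h _ _ hg hh =>
    rw [map_mul, mul_assoc]
    exact hg (hh hx)

theorem genWord_one : D.genWord 1 = 1 := by
  simpa [artinWord] using genWord_wordProd (D := D) (ω := []) (by simp [CoxeterSystem.IsReduced])

theorem span_range_genWord : Submodule.span D.Coeff (Set.range D.genWord) = ⊤ := by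
  have hone : (1 : D.MarinAlgebra) ∈ Submodule.span D.Coeff (Set.range D.genWord) :=
    Submodule.subset_span ⟨1, genWord_one⟩
  rw [eq_top_iff]
  intro x _
  obtain ⟨y, rfl⟩ := D.quotientMap_surjective x
  induction y using SkewMonoidAlgebra.induction_on with
  | zero => simp
  | single g c =>
    rw [quotientMap_single, ← mul_one (D.gen g)]
    exact Submodule.smul_mem _ _ (gen_mul_mem_span g hone)
  | add x y hx hy => rw [map_add]; exact add_mem (hx trivial) (hy trivial)

/-- The evaluation of the regular representation at the basis vector `1`. -/
def evalOne (hD : D.IsCompatible) : D.MarinAlgebra →ₗ[D.Coeff] (W →₀ D.Coeff) where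
  toFun x := regularRep hD x (Finsupp.single 1 1)
  map_add' x y := by rw [map_add, LinearMap.add_apply]
  map_smul' c x := by
    rw [coeff_smul_def, map_mul, regularRep, liftHom_coeffHom]
    rfl

theorem evalOne_genWord (hD : D.IsCompatible) (w : W) :
    evalOne hD (D.genWord w) = Finsupp.single w 1 := by
  obtain ⟨ω, hω, rfl⟩ := cs.exists_isReduced w
  rw [genWord_wordProd hω]
  change regularRep hD (D.gen (artinWord M ω)) (Finsupp.single 1 1) = _
  rw [regularRep, liftHom_gen, artinRep_artinWord, prod_leftOp_single_one hω]

theorem linearIndependent_genWord (hD : D.IsCompatible) :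
    LinearIndependent D.Coeff D.genWord := by
  refine LinearIndependent.of_comp (evalOne hD) ?_
  have h : evalOne hD ∘ D.genWord = Finsupp.basisSingleOne (R := D.Coeff) (ι := W) := by
    funext w
    simp [evalOne_genWord]
  rw [h]
  exact Module.Basis.linearIndependent _

/-- The basis `(g_w)` of the Marin algebra. -/
def stdBasis (hD : D.IsCompatible) : Module.Basis W D.Coeff D.MarinAlgebra :=
  Module.Basis.mk (linearIndependent_genWord hD) span_range_genWord.ge

theorem stdBasis_wordProd (hD : D.IsCompatible) {ω : List B} (hω : cs.IsReduced ω) :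
    stdBasis hD (cs.wordProd ω) = D.gen (artinWord M ω) := by
  rw [stdBasis, Module.Basis.mk_apply, genWord_wordProd hω]

end Algebra

end MarinDatum

/-! ### Functoriality in the coefficients -/

namespace MarinDatum

section Functoriality

variable {B W : Type*} [Group W] {M : CoxeterMatrix B} {cs : CoxeterSystem M W}
  {k A A' : Type*} [CommRing k] [CommRing A] [Algebra k A] [CommRing A'] [Algebra k A']
  (D : MarinDatum cs k A) (D' : MarinDatum cs k A')

/-- The canonical map from the coefficients to the Marin algebra, as a homomorphism of algebras. -/
def coeffAlgHom : D.Coeff →ₐ[k] D.MarinAlgebra :=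
  { D.coeffHom with
    commutes' := fun r => D.quotientMap.commutes r }

/-- A homomorphism `A → A'`, viewed as a homomorphism between the coefficient algebras. -/
def coeffMap (θ : A →ₐ[k] A') : D.Coeff →ₐ[k] D'.Coeff :=
  ((D'.toCoeff : A' →ₐ[k] D'.Coeff).comp θ).comp (D.toCoeff.symm : D.Coeff →ₐ[k] A)

variable {D D'} in
theorem coeffMap_smul {θ : A →ₐ[k] A'} (hθ : ∀ w c, θ (D.ρ w c) = D'.ρ w (θ c))
    (x : ArtinGroup M) (c : D.Coeff) :
    D.coeffMap D' θ (x • c) = x • D.coeffMap D' θ c := by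
  simp [coeffMap, artin_smul_def, hθ]

variable {D D'} in
theorem coeffMap_param {θ : A →ₐ[k] A'} (ha : ∀ i, θ (D.a i) = D'.a i) (i : B) :
    D.coeffMap D' θ (D.param i) = D'.param i := by
  simp [coeffMap, param, ha]

section mapHom

variable (θ : A →ₐ[k] A') (hθ : ∀ w c, θ (D.ρ w c) = D'.ρ w (θ c))
  (ha : ∀ i, θ (D.a i) = D'.a i)

/-- An equivariant homomorphism of coefficient algebras that respects the parameters induces a
homomorphism of Marin algebras. -/
def mapHom : D.MarinAlgebra →ₐ[k] D'.MarinAlgebra :=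
  D.liftHom (D'.coeffAlgHom.comp (D.coeffMap D' θ)) D'.gen
    (fun x c => by
      rw [AlgHom.comp_apply, coeffMap_smul hθ]
      exact D'.coeffHom_smul_mul_gen x _)
    (fun i => by
      rw [AlgHom.comp_apply, AlgHom.comp_apply, map_sub (D.coeffMap D' θ), map_one,
        coeffMap_param ha]
      exact D'.gen_of_mul_gen_of i)

theorem mapHom_coeffHom (c : A) :
    D.mapHom D' θ hθ ha (D.coeffHom (D.toCoeff c)) = D'.coeffHom (D'.toCoeff (θ c)) :=
  D.liftHom_coeffHom _ _ _ _ _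

theorem mapHom_gen (x : ArtinGroup M) : D.mapHom D' θ hθ ha (D.gen x) = D'.gen x :=
  D.liftHom_gen _ _ _ _ _

theorem mapHom_surjective (hsurj : Function.Surjective θ) :
    Function.Surjective (D.mapHom D' θ hθ ha) := by
  intro y
  rw [← AlgHom.mem_range]
  obtain ⟨z, rfl⟩ := D'.quotientMap_surjective y
  induction z using SkewMonoidAlgebra.induction_on with
  | zero => rw [map_zero]; exact zero_mem _
  | single g c =>
    rw [quotientMap_single, coeff_smul_def]
    obtain ⟨b, hb⟩ := hsurj (D'.toCoeff.symm c)
    refine mul_mem ⟨D.coeffHom (D.toCoeff b), ?_⟩ ⟨D.gen g, D.mapHom_gen D' θ hθ ha g⟩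
    refine (D.mapHom_coeffHom D' θ hθ ha b).trans ?_
    rw [hb, AlgEquiv.apply_symm_apply]
  | add x y hx hy => rw [map_add]; exact add_mem hx hy

end mapHom

end Functoriality

end MarinDatum

/-! ### The Marin datum of a monoid algebra -/

section Monoid

variable {B W E R : Type*} [Group W] {M : CoxeterMatrix B} [CommMonoid E] [CommRing R]

theorem one_sub_hatUnit_mul_domCongr {σ : MulAut E} {e : E} (he : IsIdempotentElem e)
    (h : ∀ x, e * x = e * σ x) (u : Rˣ) (c : MonoidAlgebra R E) :
    (1 - (hatUnit u e he).val) * MonoidAlgebra.domCongr R R σ c =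
      (1 - (hatUnit u e he).val) * c := by
  have hparam : 1 - (hatUnit u e he).val = MonoidAlgebra.single e (1 - (u : R)) := by
    rw [hatUnit, sub_add_cancel_left, ← MonoidAlgebra.single_neg, neg_sub]
  rw [hparam]
  induction c using MonoidAlgebra.induction_linear with
  | zero => simp
  | add x y hx hy => rw [map_add, mul_add, hx, hy, mul_add]
  | single x r =>
    rw [MonoidAlgebra.domCongr_single, MonoidAlgebra.single_mul_single,
      MonoidAlgebra.single_mul_single, ← h]

theorem isCompatible_monoidDatum {cs : CoxeterSystem M W} {ρ : W →* MulAut E} {e : B → E}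
    (h : IsMarinIwahoriHeckeMonoid cs ρ e)
    (u : B → Rˣ) (hu : IsEquivariant cs (fun _ r => r) u) :
    (monoidDatum cs ρ e h.idempotent h.equivariant u hu).IsCompatible :=
  fun i c => one_sub_hatUnit_mul_domCongr (h.idempotent i) (h.mul_eq i) (u i) c

theorem augmentation_single (x : E) (r : R) :
    augmentation R E (MonoidAlgebra.single x r) = r := by
  simp [augmentation]

theorem augmentation_domCongr (σ : MulAut E) (c : MonoidAlgebra R E) :
    augmentation R E (MonoidAlgebra.domCongr R R σ c) = augmentation R E c := by
  induction c using MonoidAlgebra.induction_linear with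
  | zero => simp
  | add x y hx hy => simp only [map_add, hx, hy]
  | single x r => rw [MonoidAlgebra.domCongr_single, augmentation_single, augmentation_single]

theorem augmentation_hatUnit (u : Rˣ) {e : E} (he : IsIdempotentElem e) :
    augmentation R E (hatUnit u e he).val = u := by
  rw [hatUnit, map_add, map_one, augmentation_single, add_sub_cancel]

theorem augmentation_surjective : Function.Surjective (augmentation R E) :=
  fun r => ⟨MonoidAlgebra.single 1 r, augmentation_single 1 r⟩

theorem isMarinIwahoriHeckeMonoid_orbit {cs : CoxeterSystem M W} {ρ : W →* MulAut E} {e : B → E}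
    (hidem : ∀ i, IsIdempotentElem (e i)) (hequiv : IsEquivariant cs (fun w x => ρ w x) e)
    (hmul : ∀ (i j : B) (w : W), e i * ρ w (e j) = e i * ρ (cs.simple i * w) (e j)) :
    IsMarinIwahoriHeckeMonoid cs (orbitAction ρ e) (orbitMap ρ e) where
  idempotent i := Subtype.ext (hidem i)
  equivariant w i j h := Subtype.ext (hequiv w i j h)
  mul_eq := by
    rintro i ⟨x, hx⟩
    refine Subtype.ext ?_
    change e i * x = e i * ρ (cs.simple i) x
    induction hx using Submonoid.closure_induction with
    | mem x hx =>
      obtain ⟨w, j, rfl⟩ := hx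
      rw [hmul i j w, map_mul, MulAut.mul_apply]
    | one => rw [map_one]
    | mul x y _ _ hx hy =>
      calc e i * (x * y) = (e i * x) * (e i * y) := by
            rw [mul_mul_mul_comm, (hidem i).eq]
        _ = (e i * ρ (cs.simple i) x) * (e i * ρ (cs.simple i) y) := by rw [hx, hy]
        _ = e i * ρ (cs.simple i) (x * y) := by
            rw [mul_mul_mul_comm, (hidem i).eq, map_mul]

end Monoid

end BraidsTies

end

theorem mainTheorem2_general {B W E : Type*} [Group W] [CommMonoid E] {M : CoxeterMatrix B}
    (cs : CoxeterSystem M W) (ρ : W →* MulAut E) (e : B → E) (hidem : ∀ i, IsIdempotentElem (e i))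
    (hequiv : IsEquivariant cs (fun w x => ρ w x) e)
    (hmul : ∀ (i j : B) (w : W), e i * ρ w (e j) = e i * ρ (cs.simple i * w) (e j))
    {R : Type*} [CommRing R] (u : B → Rˣ) (hu : IsEquivariant cs (fun _ r => r) u) :
    let D := monoidDatum cs (orbitAction ρ e) (orbitMap ρ e) (fun i => Subtype.ext (hidem i))
      (fun w i j hw => Subtype.ext (hequiv w i j hw)) u hu
    let H := heckeDatum cs u hu
    IsMarinIwahoriHeckeMonoid cs (orbitAction ρ e) (orbitMap ρ e) ∧
    (∃ b : Module.Basis W D.Coeff D.MarinAlgebra,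
      ∀ ω : List B, cs.IsReduced ω → b (cs.wordProd ω) = D.gen (artinWord M ω)) ∧
    (∃ f : D.MarinAlgebra →ₐ[R] IwahoriHeckeAlgebra cs u hu,
      (∀ c : MonoidAlgebra R (orbitSubmonoid ρ e),
        f (D.coeffHom (D.toCoeff c)) =
          H.coeffHom (H.toCoeff (augmentation R (orbitSubmonoid ρ e) c))) ∧
      (∀ x : ArtinGroup M, f (D.gen x) = H.gen x) ∧ Function.Surjective f) := by
  intro D H
  have hE : IsMarinIwahoriHeckeMonoid cs (orbitAction ρ e) (orbitMap ρ e) :=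
    isMarinIwahoriHeckeMonoid_orbit hidem hequiv hmul
  have hD : D.IsCompatible := isCompatible_monoidDatum hE u hu
  have hθ (w : W) (c : MonoidAlgebra R (orbitSubmonoid ρ e)) :
      augmentation R _ (D.ρ w c) = H.ρ w (augmentation R _ c) :=
    augmentation_domCongr _ c
  have ha (i : B) : augmentation R _ (D.a i).val = H.a i :=
    augmentation_hatUnit (u i) (hE.idempotent i)
  exact ⟨hE, ⟨MarinDatum.stdBasis hD, fun _ hω => MarinDatum.stdBasis_wordProd hD hω⟩,
    D.mapHom H _ hθ ha, D.mapHom_coeffHom H _ hθ ha, D.mapHom_gen H _ hθ ha,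
    D.mapHom_surjective H _ hθ ha augmentation_surjective⟩

theorem mainTheorem2 {B W B' U : Type*} [Group W] [Group U] {M : CoxeterMatrix B}
    {N : CoxeterMatrix B'} (cs : CoxeterSystem M W) (ct : CoxeterSystem N U) (φ : W →* U)
    (e : B → RootSubsystem ct) (h : IsJuyumayaMap cs ct φ e) {R : Type*} [CommRing R]
    (u : B → Rˣ) (hu : IsEquivariant cs (fun _ r => r) u) :
    IsMarinIwahoriHeckeMonoid cs (orbitAction (rhoPhi ct φ) e) (orbitMap (rhoPhi ct φ) e) ∧
    (∃ b : Module.Basis W (juyumayaDatum h u hu).Coeff (juyumayaDatum h u hu).MarinAlgebra,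
      ∀ ω : List B, cs.IsReduced ω →
        b (cs.wordProd ω) = (juyumayaDatum h u hu).gen (artinWord M ω)) ∧
    (∃ f : (juyumayaDatum h u hu).MarinAlgebra →ₐ[R] IwahoriHeckeAlgebra cs u hu,
      (∀ c : MonoidAlgebra R (SigmaOrbit ct φ e),
        f ((juyumayaDatum h u hu).coeffHom ((juyumayaDatum h u hu).toCoeff c)) =
          (heckeDatum cs u hu).coeffHom
            ((heckeDatum cs u hu).toCoeff (augmentation R (SigmaOrbit ct φ e) c))) ∧
      (∀ x : ArtinGroup M, f ((juyumayaDatum h u hu).gen x) = (heckeDatum cs u hu).gen x) ∧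
      Function.Surjective f) :=
  mainTheorem2_general cs (rhoPhi ct φ) e (fun i => RootSubsystem.mul_self (e i)) h.equivariant
    h.generate_eq u hu
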